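/- Let $N$ be a type $\mathrm{II}_1$ factor, let $G$ be a finite group, and let $\alpha$ be an outer action of $G$ on $N$, that is, an action by $*$-automorphisms such that for every $g\neq 1$ and $a\in N$, if $\alpha_g(x)a=ax$ for all $x\in N$, then $a=0$. Let $M=N\rtimes_\alpha G$ be the crossed product, regard $N$ as a von Neumann subalgebra of $M$, let $v_g\in M$ $(g\in G)$ be the canonical unitaries with $\alpha_g(x)=v_gxv_g^*$ for $x\in N$, and let $\tau$ be the (unique) faithful normal tracial state of $M$. For a von Neumann subalgebra $A\subseteq M$ let $E_A:M\to A$ be the $\tau$-preserving conditional expectation. Put $\eta(t)=-t\log t$ for $0<t\le 1$ and $\eta(0)=0$, and for von Neumann subalgebras $A,B\subseteq M$ let $$h(A\mid B)=\sup \sum_i\bigl(\tau\,\eta(E_B(E_A(x_i)))-\tau\,\eta(E_A(x_i))\bigr),$$ where the supremum is over all finite families $(x_i)$ of positive elements of $M$ with $\sum_i x_i=1$. Let $u\in M$ be a unitary, with Fourier expansion $u=\sum_{g\in G}u_gv_g$, where $u_g=E_N(uv_g^*)\in N$. If $$h(N\mid uNu^*)=\log|G|,$$ then $\tau(u_gu_g^*)=\dfrac{1}{|G|}$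 for every $g\in G$. -/

import Mathlib

noncomputable section

namespace SubfactorEntropy

/-- The elements of a von Neumann algebra `M` acting on `K`, as a type. -/
abbrev Elem {K : Type*} [NormedAddCommGroup K] [InnerProductSpace ℂ K] [CompleteSpace K]
    (M : VonNeumannAlgebra K) : Type _ :=
  M.toStarSubalgebra

section Generated

variable {K : Type*} [NormedAddCommGroup K] [InnerProductSpace ℂ K] [CompleteSpace K]

/-- The von Neumann algebra generated by a set `s` of bounded operators: the double commutant of
`s ∪ s*`. -/
def generated (s : Set (K →L[ℂ] K)) : VonNeumannAlgebra K where
  toStarSubalgebra :=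
    StarSubalgebra.centralizer ℂ (StarSubalgebra.centralizer ℂ s : Set (K →L[ℂ] K))
  centralizer_centralizer' := by
    change Set.centralizer (Set.centralizer ((StarSubalgebra.centralizer ℂ
      (StarSubalgebra.centralizer ℂ s : Set (K →L[ℂ] K)) : StarSubalgebra ℂ (K →L[ℂ] K)) :
        Set (K →L[ℂ] K))) = ((StarSubalgebra.centralizer ℂ
      (StarSubalgebra.centralizer ℂ s : Set (K →L[ℂ] K)) : StarSubalgebra ℂ (K →L[ℂ] K)) :
        Set (K →L[ℂ] K))
    rw [StarSubalgebra.coe_centralizer_centralizer, Set.centralizer_centralizer_centralizer]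

theorem subset_generated {s : Set (K →L[ℂ] K)} {a : K →L[ℂ] K} (ha : a ∈ s) :
    a ∈ (generated s).toStarSubalgebra := by
  change a ∈ ((StarSubalgebra.centralizer ℂ
      (StarSubalgebra.centralizer ℂ s : Set (K →L[ℂ] K)) : StarSubalgebra ℂ (K →L[ℂ] K)) :
        Set (K →L[ℂ] K))
  rw [StarSubalgebra.coe_centralizer_centralizer]
  exact Set.subset_centralizer_centralizer (Or.inl ha)

end Generated

section Entropy

variable {K : Type*} [NormedAddCommGroup K] [InnerProductSpace ℂ K] [CompleteSpace K]
variable {M : VonNeumannAlgebra K}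

/-- `τ` is a faithful normal tracial state on `M`. Normality is stated as `σ`-weak continuity of a
positive functional: `τ` is a countable sum of vector functionals (the vectors are automatically
square summable, as one sees from `x = 1`). -/
structure IsFaithfulNormalTracialState (τ : Elem M →ₗ[ℂ] ℂ) : Prop where
  map_one : τ 1 = 1
  nonneg : ∀ x : Elem M, ∃ r : ℝ, 0 ≤ r ∧ τ (star x * x) = r
  tracial : ∀ x y : Elem M, τ (x * y) = τ (y * x)
  faithful : ∀ x : Elem M, τ (star x * x) = 0 → x = 0
  normal : ∃ ξ : ℕ → K, ∀ x : Elem M,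
    HasSum (fun n => inner ℂ (ξ n) ((x : K →L[ℂ] K) (ξ n))) (τ x)

/-- `M` is a factor: its center consists of the scalars. -/
def IsFactor (M : VonNeumannAlgebra K) : Prop :=
  ∀ z : Elem M, (∀ x : Elem M, z * x = x * z) → ∃ c : ℂ, z = c • (1 : Elem M)

/-- `M` is a type II₁ factor: an infinite-dimensional factor with a faithful normal tracial
state. -/
structure IsTypeIIOneFactor (M : VonNeumannAlgebra K) : Prop where
  factor : IsFactor M
  infinite_dimensional : ¬ FiniteDimensional ℂ (Elem M)
  exists_trace : ∃ τ : Elem M →ₗ[ℂ] ℂ, IsFaithfulNormalTracialState τ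

/-- Positivity of an element of `M`, as an operator. -/
def IsPos (x : Elem M) : Prop := (x : K →L[ℂ] K).IsPositive

/-- `E` is a `τ`-preserving conditional expectation of `M` onto the subalgebra `B`. -/
structure IsConditionalExpectation (τ : Elem M →ₗ[ℂ] ℂ) (B : StarSubalgebra ℂ (Elem M))
    (E : Elem M →ₗ[ℂ] Elem M) : Prop where
  mem : ∀ x, E x ∈ B
  apply_of_mem : ∀ b ∈ B, E b = b
  bimodule : ∀ b ∈ B, ∀ c ∈ B, ∀ x, E (b * x * c) = b * E x * c
  positive : ∀ x, IsPos x → IsPos (E x)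
  trace : ∀ x, τ (E x) = τ x

open Classical in
/-- The `τ`-preserving conditional expectation `E_B` of `M` onto a von Neumann subalgebra `B`
(it exists and is unique if `τ` is a faithful normal tracial state). -/
def condExp (τ : Elem M →ₗ[ℂ] ℂ) (B : StarSubalgebra ℂ (Elem M)) : Elem M →ₗ[ℂ] Elem M :=
  if h : ∃ E, IsConditionalExpectation τ B E then h.choose else 0

theorem cfc_mem (f : ℝ → ℝ) (x : Elem M) :
    cfc f (x : K →L[ℂ] K) ∈ M.toStarSubalgebra := by
  by_cases hx : IsSelfAdjoint (x : K →L[ℂ] K)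
  · have h : cfc f (x : K →L[ℂ] K) ∈ (M : Set (K →L[ℂ] K)) := by
      rw [← VonNeumannAlgebra.centralizer_centralizer M]
      intro y hy
      have hxy : Commute (x : K →L[ℂ] K) y := hy _ x.2
      exact (hxy.cfc_real f).symm
    exact h
  · rw [cfc_apply_of_not_predicate _ hx]
    exact zero_mem _

/-- `η(x)` for a positive element `x` of `M`, where `η(t) = -t log t` and `η(0) = 0`, by the
continuous functional calculus. -/
def etaOp (x : Elem M) : Elem M :=
  ⟨cfc Real.negMulLog (x : K →L[ℂ] K), cfc_mem _ _⟩

/-- The conditional relative entropy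
`h(A | B) = sup ∑ i, (τ η E_B (E_A (x i)) - τ η E_A (x i))`, the supremum being over all finite
families `(x i)` of positive elements of `M` with sum `1`. -/
def relEntropy (τ : Elem M →ₗ[ℂ] ℂ) (A B : StarSubalgebra ℂ (Elem M)) : EReal :=
  ⨆ (n : ℕ) (x : Fin n → Elem M) (_ : (∀ i, IsPos (x i)) ∧ ∑ i, x i = 1),
    ((∑ i, ((τ (etaOp (condExp τ B (condExp τ A (x i))))).re
      - (τ (etaOp (condExp τ A (x i)))).re) : ℝ) : EReal)

/-- The subalgebra `u B u*`. -/
def conj (u : unitary (Elem M)) (B : StarSubalgebra ℂ (Elem M)) : StarSubalgebra ℂ (Elem M) :=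
  B.map (Unitary.conjStarAlgAut ℂ (Elem M) u : Elem M →⋆ₐ[ℂ] Elem M)

end Entropy

section CrossedProduct

variable {H : Type*} [NormedAddCommGroup H] [InnerProductSpace ℂ H] [CompleteSpace H]
variable {N : VonNeumannAlgebra H}
variable {G : Type*} [Group G]

/-- The action `α` of `G` on `N` by `*`-automorphisms is outer (free): for `g ≠ 1`, if
`α_g(x) a = a x` for all `x`, then `a = 0`. -/
def IsOuterAction (α : G →* (Elem N ≃⋆ₐ[ℂ] Elem N)) : Prop :=
  ∀ g : G, g ≠ 1 → ∀ a : Elem N, (∀ x : Elem N, α g x * a = a * x) → a = 0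

variable [Fintype G]

/-- The Hilbert space `ℓ²(G, H)`. -/
abbrev L2 (G : Type*) [Fintype G] (H : Type*) [NormedAddCommGroup H] [InnerProductSpace ℂ H] :
    Type _ :=
  PiLp 2 (fun _ : G => H)

/-- The representation `(π(x) ξ)(g) = α_g⁻¹(x) ξ(g)` of `N` on `ℓ²(G, H)`. -/
def piOp (α : G →* (Elem N ≃⋆ₐ[ℂ] Elem N)) (x : Elem N) : L2 G H →L[ℂ] L2 G H :=
  ((PiLp.continuousLinearEquiv 2 ℂ (fun _ : G => H)).symm : (G → H) →L[ℂ] L2 G H) ∘L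
    ContinuousLinearMap.pi
      (fun g => ((α g⁻¹ x : Elem N) : H →L[ℂ] H) ∘L PiLp.proj 2 (fun _ : G => H) g)

theorem piOp_apply (α : G →* (Elem N ≃⋆ₐ[ℂ] Elem N)) (x : Elem N) (ξ : L2 G H) (g : G) :
    piOp α x ξ g = ((α g⁻¹ x : Elem N) : H →L[ℂ] H) (ξ g) := rfl

/-- The translation `(λ_g ξ)(h) = ξ(g⁻¹ h)` on `ℓ²(G, H)`. -/
def transOp (H : Type*) [NormedAddCommGroup H] [InnerProductSpace ℂ H] (g : G) :
    L2 G H →L[ℂ] L2 G H :=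
  (LinearIsometryEquiv.piLpCongrLeft 2 ℂ H (Equiv.mulLeft g)).toContinuousLinearEquiv

/-- The crossed product `N ⋊_α G`: the von Neumann algebra on `ℓ²(G, H)` generated by `π(N)` and
the translations `λ_g`. -/
def crossedProduct (α : G →* (Elem N ≃⋆ₐ[ℂ] Elem N)) : VonNeumannAlgebra (L2 G H) :=
  generated (Set.range (piOp α) ∪ Set.range (transOp H))

/-- The representation `π` of `N`, as a `*`-homomorphism. -/
def piHom (α : G →* (Elem N ≃⋆ₐ[ℂ] Elem N)) : Elem N →⋆ₐ[ℂ] (L2 G H →L[ℂ] L2 G H) where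
  toFun := piOp α
  map_one' := by ext ξ g; simp [piOp_apply]
  map_mul' x y := by ext ξ g; simp [piOp_apply]
  map_zero' := by ext ξ g; simp [piOp_apply]
  map_add' x y := by ext ξ g; simp [piOp_apply]
  commutes' c := by
    ext ξ g
    simp [piOp_apply, Algebra.algebraMap_eq_smul_one]
  map_star' x := by
    rw [ContinuousLinearMap.star_eq_adjoint, ContinuousLinearMap.eq_adjoint_iff]
    intro ξ ζ
    simp only [PiLp.inner_apply, piOp_apply]
    refine Finset.sum_congr rfl fun g _ => ?_
    rw [map_star, StarMemClass.coe_star, ContinuousLinearMap.star_eq_adjoint,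
      ContinuousLinearMap.adjoint_inner_left]

/-- The embedding of `N` into `N ⋊_α G`. -/
def embed (α : G →* (Elem N ≃⋆ₐ[ℂ] Elem N)) : Elem N →⋆ₐ[ℂ] Elem (crossedProduct α) :=
  StarAlgHom.codRestrict (piHom α) _ (fun x => subset_generated (Or.inl ⟨x, rfl⟩))

/-- The copy of `N` inside `N ⋊_α G`. -/
def base (α : G →* (Elem N ≃⋆ₐ[ℂ] Elem N)) : StarSubalgebra ℂ (Elem (crossedProduct α)) :=
  (embed α).range

/-- The unitaries `v_g` of `N ⋊_α G` which implement the action. -/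
def implementer (α : G →* (Elem N ≃⋆ₐ[ℂ] Elem N)) (g : G) : Elem (crossedProduct α) :=
  ⟨transOp H g, subset_generated (Or.inr ⟨g, rfl⟩)⟩

/-- The coefficient `x_g = E_N(x v_g*)` in the Fourier expansion `x = ∑ g, x_g v_g`. -/
def coeff (α : G →* (Elem N ≃⋆ₐ[ℂ] Elem N)) (τ : Elem (crossedProduct α) →ₗ[ℂ] ℂ)
    (x : Elem (crossedProduct α)) (g : G) : Elem (crossedProduct α) :=
  condExp τ (base α) (x * star (implementer α g))

end CrossedProduct

end SubfactorEntropy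

end

/-! Let `y ≥ 0` in `N` and write `u = ∑ u_g v_g`. Since `E_N` kills `x v_g` for `x ∈ N`, `g ≠ 1`,
the expectation onto `uNu*` has Kraus form on `N`: `E_{uNu*}(y) = u E_N(u* y u) u* = ∑ w_g* w_g`
with `w_g = y^{1/2} u_g v_g u*`. Also `∑ w_g w_g* = y^{1/2} (∑ u_g u_g*) y^{1/2} = y`, because `uu*
= 1`.

Operator monotonicity of `log` gives `τη(∑ w_g* w_g) ≤ ∑ τη(w_g* w_g)`, traciality replaces `w_g*
w_g` by `w_g w_g*`, and Klein's inequality compares `w_g w_g*` with `c_g y` for arbitrary weights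
`c_g > 0` (`IsRealTrace.entropy_kraus_le`). Summing over a partition of unity gives, with `t_g =
τ(u_g u_g*)`, the bound `h(N | uNu*) ≤ ∑ (-t_g log c_g + c_g - t_g)` (`relEntropy_le`). Here `∑ t_g
= 1`. If the left side is `log |G|`, then `log |G| ≤ -∑ t_g log c_g` for every strictly positive
probability vector `c`, and this forces `t` to be uniform (`eq_inv_card_of_log_le`).

The rest justifies the formulas for `E_N`. Every element of `N ⋊ G` is a finite Fourier series
(`exists_eq_fourier`), and a normal tracial state vanishes on `N v_g` for `g ≠ 1` by outerness
(`trace_embed_mul_implementer`). Both need the trace of the factor `N` to be invariant under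
automorphisms (`IsFactor.trace_starAlgEquiv`). That follows from uniqueness of the trace, by
averaging over unitaries, once automorphisms are known to be continuous on bounded sets for the
trace norm. -/

noncomputable section

/-! ### Trace inequalities in a C*-algebra: Klein's inequality for the exponential. -/

namespace SubfactorEntropy

/-- The real part of a tracial state on a unital C*-algebra. -/
structure IsRealTrace {A : Type*} [CStarAlgebra A] (t : A →ₗ[ℝ] ℝ) : Prop where
  map_one : t 1 = 1
  nonneg : ∀ x, 0 ≤ t (star x * x)
  tracial : ∀ x y, t (x * y) = t (y * x)
  map_star : ∀ x, t (star x) = t x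

namespace IsRealTrace

open Filter Topology NormedSpace

variable {A : Type*} [CStarAlgebra A] {t : A →ₗ[ℝ] ℝ}

theorem map_algebraMap (ht : IsRealTrace t) (r : ℝ) : t (algebraMap ℝ A r) = r := by
  rw [Algebra.algebraMap_eq_smul_one, map_smul, ht.map_one, smul_eq_mul, mul_one]

section Order

variable [PartialOrder A] [StarOrderedRing A]

theorem nonneg_of_nonneg (ht : IsRealTrace t) {x : A} (hx : 0 ≤ x) : 0 ≤ t x := by
  obtain ⟨s, rfl⟩ := CStarAlgebra.nonneg_iff_eq_star_mul_self.mp hx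
  exact ht.nonneg s

theorem mono (ht : IsRealTrace t) {x y : A} (h : x ≤ y) : t x ≤ t y := by
  have := ht.nonneg_of_nonneg (sub_nonneg.mpr h)
  rw [map_sub] at this
  linarith

end Order

theorem abs_le_norm (ht : IsRealTrace t) (x : A) : |t x| ≤ ‖x‖ := by
  let := CStarAlgebra.spectralOrder A
  let := CStarAlgebra.spectralOrderedRing A
  have key : ∀ x : A, t x ≤ ‖x‖ := by
    intro x
    have h1 : t x = t ((2⁻¹ : ℝ) • (x + star x)) := by
      rw [map_smul, map_add, ht.map_star, smul_eq_mul]; ring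
    have hs : IsSelfAdjoint ((2⁻¹ : ℝ) • (x + star x)) := by
      rw [IsSelfAdjoint, star_smul, star_add, star_star, add_comm]; rfl
    have h2 : ‖(2⁻¹ : ℝ) • (x + star x)‖ ≤ ‖x‖ := by
      rw [norm_smul]
      have := norm_add_le x (star x)
      rw [norm_star] at this
      norm_num
      linarith
    rw [h1]
    refine le_trans ?_ h2
    have := ht.mono (hs.le_algebraMap_norm_self)
    rwa [ht.map_algebraMap] at this
  refine abs_le.mpr ⟨?_, key x⟩
  have := key (-x)
  rw [map_neg, norm_neg] at this
  linarith

theorem continuous (ht : IsRealTrace t) : Continuous t :=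
  AddMonoidHomClass.continuous_of_bound t 1 fun x => by
    rw [one_mul]; exact ht.abs_le_norm x

/-- Expand `0 ≤ t(|P - QR|²)` with `P = e^{a/2}`, `Q = e^{(1/2 - r)a}`, `R = e^{rb}`, and collect
the factors by traciality. -/
theorem exp_interpolation_step (ht : IsRealTrace t) {a b : A} (ha : IsSelfAdjoint a)
    (hb : IsSelfAdjoint b) (r : ℝ) :
    2 * t (exp ((1 - r) • a) * exp (r • b)) ≤
      t (exp a) + t (exp ((1 - 2 * r) • a) * exp ((2 * r) • b)) := by
  have hadd : ∀ (c : A) (p q : ℝ), exp (p • c) * exp (q • c) = exp ((p + q) • c) := by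
    intro c p q
    let : NormedAlgebra ℚ A := .restrictScalars ℚ ℝ A
    rw [add_smul, exp_add_of_commute]
    exact ((Commute.refl c).smul_left p).smul_right q
  have hsa : ∀ {c : A} (_ : IsSelfAdjoint c) (p : ℝ), star (exp (p • c)) = exp (p • c) := by
    intro c hc p
    exact (IsSelfAdjoint.exp ((IsSelfAdjoint.all p).smul hc)).star_eq
  set P := exp ((1 / 2 : ℝ) • a)
  set Q := exp ((1 / 2 - r) • a)
  set R := exp (r • b)
  have hP : star P = P := hsa ha _
  have hQ : star Q = Q := hsa ha _
  have hR : star R = R := hsa hb _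
  have h0 := ht.nonneg (P - Q * R)
  have hexpand : star (P - Q * R) * (P - Q * R)
      = P * P - P * Q * R - R * (Q * P) + R * (Q * Q * R) := by
    rw [star_sub, star_mul, hP, hQ, hR]; noncomm_ring
  have hPP : P * P = exp a := by
    rw [hadd]; norm_num
  have hPQ : P * Q = exp ((1 - r) • a) := by
    rw [hadd]; congr 2; ring
  have hQP : Q * P = exp ((1 - r) • a) := by
    rw [hadd]; congr 2; ring
  have hQQ : Q * Q = exp ((1 - 2 * r) • a) := by
    rw [hadd]; congr 2; ring
  have hRR : R * R = exp ((2 * r) • b) := by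
    rw [hadd]; congr 2; ring
  rw [hexpand, hPP, hPQ, hQP, hQQ, map_add, map_sub, map_sub, ht.tracial R, ht.tracial R, mul_assoc,
    hRR] at h0
  linarith

/-- With `f(r) = t(e^{(1-r)a} e^{rb})` the previous step reads `2 f(r) ≤ f(0) + f(2r)`. Halving
repeatedly from `r = 1` puts `f` below its chord at the dyadic points `2^{-k}`, which is all that
the derivative at `0` needs. -/
theorem exp_interpolation (ht : IsRealTrace t) {a b : A} (ha : IsSelfAdjoint a)
    (hb : IsSelfAdjoint b) (k : ℕ) :
    t (exp ((1 - (1 / 2 : ℝ) ^ k) • a) * exp (((1 / 2 : ℝ) ^ k) • b)) ≤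
      t (exp a) + (1 / 2 : ℝ) ^ k * (t (exp b) - t (exp a)) := by
  induction k with
  | zero => simp
  | succ k ih =>
    have h := ht.exp_interpolation_step ha hb ((1 / 2 : ℝ) ^ (k + 1))
    have e : 2 * (1 / 2 : ℝ) ^ (k + 1) = (1 / 2) ^ k := by rw [pow_succ]; ring
    rw [e] at h
    have e' : (1 / 2 : ℝ) ^ (k + 1) = (1 / 2) ^ k / 2 := by rw [pow_succ]; ring
    rw [e'] at h ⊢
    linarith

/-- Klein's inequality for the exponential function. -/
theorem klein_exp (ht : IsRealTrace t) {a b : A} (ha : IsSelfAdjoint a) (hb : IsSelfAdjoint b) :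
    t (exp a * (b - a)) ≤ t (exp b) - t (exp a) := by
  let T : A →L[ℝ] ℝ := ⟨t, ht.continuous⟩
  let f : ℝ → ℝ := fun r => t (exp ((1 - r) • a) * exp (r • b))
  have h1 : HasDerivAt (fun r : ℝ => exp ((1 - r) • a)) (-(exp a * a)) 0 := by
    have h := (hasDerivAt_exp_smul_const (𝕂 := ℝ) a (1 - 0)).scomp (0 : ℝ)
      ((hasDerivAt_id (0 : ℝ)).const_sub 1)
    simpa [Function.comp_def] using! h
  have h2 : HasDerivAt (fun r : ℝ => exp (r • b)) b 0 := by
    simpa using! hasDerivAt_exp_smul_const (𝕂 := ℝ) b 0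
  have hf : HasDerivAt f (t (exp a * (b - a))) 0 := by
    have h := T.hasFDerivAt.comp_hasDerivAt (0 : ℝ) (h1.mul h2)
    have e : -(exp a * a) * exp ((0 : ℝ) • b) + exp ((1 - (0 : ℝ)) • a) * b = exp a * (b - a) := by
      simp [mul_sub]; abel
    rw [e] at h
    exact h
  have hpos : ∀ k : ℕ, (0 : ℝ) < (1 / 2) ^ k := fun k => by positivity
  have hlim : Tendsto (fun k : ℕ => (1 / 2 : ℝ) ^ k) atTop (𝓝[≠] 0) :=
    tendsto_nhdsWithin_iff.mpr ⟨tendsto_pow_atTop_nhds_zero_of_lt_one (by norm_num) (by norm_num),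
      Eventually.of_forall fun k => (hpos k).ne'⟩
  have hs := (hasDerivAt_iff_tendsto_slope.mp hf).comp hlim
  -- The slopes of `f` between `0` and `2^{-k}` are at most `f(1) - f(0)`, hence so is the
  -- derivative of `f` at `0`.
  refine le_of_tendsto hs (Eventually.of_forall fun k => ?_)
  have h0 : f 0 = t (exp a) := by simp [f]
  simp only [Function.comp, slope_def_field, h0, sub_zero]
  rw [div_le_iff₀ (hpos k)]
  have := ht.exp_interpolation ha hb k
  simp only [f]
  linarith

/-- Traciality gives equal moments of `w*w` and `ww*`, hence equality for polynomials. Weierstrass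
approximation on `[-‖w‖², ‖w‖²]` does the rest. -/
theorem map_cfc_star_mul_self (ht : IsRealTrace t) (w : A) {f : ℝ → ℝ} (hf : Continuous f) :
    t (cfc f (star w * w)) = t (cfc f (w * star w)) := by
  let := CStarAlgebra.spectralOrder A
  let := CStarAlgebra.spectralOrderedRing A
  have hp : ∀ p : Polynomial ℝ,
      t (Polynomial.aeval (star w * w) p) = t (Polynomial.aeval (w * star w) p) := by
    intro p
    induction p using Polynomial.induction_on' with
    | add p q hp hq => rw [map_add, map_add, map_add, map_add, hp, hq]
    | monomial n c =>
      rw [Polynomial.aeval_monomial, Polynomial.aeval_monomial, ← Algebra.smul_def,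
        ← Algebra.smul_def, map_smul, map_smul]
      congr 1
      cases n with
      | zero => simp
      | succ n =>
        have e : (w * star w) ^ (n + 1) = w * ((star w * w) ^ n * star w) := by
          rw [← mul_assoc, ← mul_pow_mul]
          rw [pow_succ, mul_assoc]
        rw [e, ht.tracial w, mul_assoc, ← pow_succ]
  have hsa1 : IsSelfAdjoint (star w * w) := IsSelfAdjoint.star_mul_self w
  have hsa2 : IsSelfAdjoint (w * star w) := IsSelfAdjoint.mul_star_self w
  refine eq_of_forall_dist_le fun ε hε => ?_
  set R := ‖w‖ * ‖w‖ with hR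
  obtain ⟨p, hpε⟩ := exists_polynomial_near_of_continuousOn (-R) R f hf.continuousOn (ε / 2)
    (half_pos hε)
  have hclose : ∀ x : A, IsSelfAdjoint x → ‖x‖ ≤ R →
      |t (cfc f x) - t (Polynomial.aeval x p)| ≤ ε / 2 := by
    intro x hx hxR
    rw [← cfc_polynomial p x, ← map_sub, ← cfc_sub f p.eval x]
    refine (ht.abs_le_norm _).trans (norm_cfc_le (by positivity) fun s hs => ?_)
    rw [Real.norm_eq_abs, abs_sub_comm]
    refine (hpε s ?_).le
    have h1 : ‖s‖ ≤ ‖x‖ := by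
      by_cases hA : Nontrivial A
      · exact spectrum.norm_le_norm_of_mem hs
      · rw [not_nontrivial_iff_subsingleton] at hA
        simp at hs
    rw [Real.norm_eq_abs] at h1
    exact abs_le.mp (h1.trans hxR)
  have h1 := hclose _ hsa1 ((norm_mul_le _ _).trans (by rw [norm_star]))
  have h2 := hclose _ hsa2 ((norm_mul_le _ _).trans (by rw [norm_star]))
  rw [hp p] at h1
  rw [Real.dist_eq]
  rw [abs_le] at h1 h2 ⊢
  constructor <;> linarith

end IsRealTrace

end SubfactorEntropy

end

/-! ### The entropy inequality for maps in Kraus form. -/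

noncomputable section

namespace SubfactorEntropy

namespace IsRealTrace

open Filter Topology

variable {A : Type*} [CStarAlgebra A] {t : A →ₗ[ℝ] ℝ}

/-- `log (x + ε)`, by the functional calculus of `x`. -/
def regLog (ε : ℝ) (x : A) : A := cfc (fun s => Real.log (s + ε)) x

theorem isSelfAdjoint_regLog {x : A} (ε : ℝ) : IsSelfAdjoint (regLog ε x) :=
  cfc_predicate _ _

theorem map_mul_algebraMap (t : A →ₗ[ℝ] ℝ) (x : A) (r : ℝ) :
    t (x * algebraMap ℝ A r) = r * t x := by
  rw [Algebra.algebraMap_eq_smul_one, mul_smul_comm, mul_one, map_smul, smul_eq_mul]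

section Order

variable [PartialOrder A] [StarOrderedRing A]

theorem continuousOn_log_add {x : A} (hx : 0 ≤ x) {ε : ℝ} (hε : 0 < ε) :
    ContinuousOn (fun s => Real.log (s + ε)) (spectrum ℝ x) := by
  refine ContinuousOn.log (by fun_prop) fun s hs => ?_
  have := spectrum_nonneg_of_nonneg hx hs
  positivity

theorem mul_regLog {x : A} (hx : 0 ≤ x) {ε : ℝ} (hε : 0 < ε) :
    x * regLog ε x = cfc (fun s => s * Real.log (s + ε)) x := by
  rw [regLog, cfc_mul (fun s => s) (fun s => Real.log (s + ε)) x (by fun_prop)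
    (continuousOn_log_add hx hε), cfc_id' ℝ x]

theorem regLog_eq_log {x : A} (hx : 0 ≤ x) {ε : ℝ} (hε : 0 < ε) :
    regLog ε x = CFC.log (x + algebraMap ℝ A ε) := by
  have h : x + algebraMap ℝ A ε = cfc (fun s => s + ε) x := by
    rw [cfc_add_const ε (fun s => s) x, cfc_id' ℝ x]
  rw [h, CFC.log, ← cfc_comp' Real.log (fun s => s + ε) x (hg := ?_)]
  · rfl
  · refine ContinuousOn.log continuousOn_id ?_
    rintro _ ⟨s, hs, rfl⟩
    have := spectrum_nonneg_of_nonneg hx hs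
    simp only
    positivity

theorem isStrictlyPositive_add {x : A} (hx : 0 ≤ x) {ε : ℝ} (hε : 0 < ε) :
    IsStrictlyPositive (x + algebraMap ℝ A ε) :=
  IsStrictlyPositive.nonneg_add hx (isStrictlyPositive_algebraMap hε)

theorem exp_regLog {x : A} (hx : 0 ≤ x) {ε : ℝ} (hε : 0 < ε) :
    NormedSpace.exp (regLog ε x) = x + algebraMap ℝ A ε := by
  rw [regLog_eq_log hx hε, CFC.exp_log _ (isStrictlyPositive_add hx hε)]

theorem regLog_mono {x y : A} (hx : 0 ≤ x) (hxy : x ≤ y) {ε : ℝ} (hε : 0 < ε) :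
    regLog ε x ≤ regLog ε y := by
  rw [regLog_eq_log hx hε, regLog_eq_log (hx.trans hxy) hε]
  have := isStrictlyPositive_add hx hε
  exact CFC.log_le_log (by gcongr)

/-- Together with `le_cfc_negMulLog`, this shows that replacing `log x` by `log (x + ε)` changes the
entropy by at most `ε`. The scalar inequality is `s (log (s + ε) - log s) ≤ ε`. -/
theorem cfc_negMulLog_le (ht : IsRealTrace t) {x : A} (hx : 0 ≤ x) {ε : ℝ} (hε : 0 < ε) :
    t (cfc Real.negMulLog x) ≤ ε - t (x * regLog ε x) := by
  have hc := continuousOn_log_add hx hε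
  have h : cfc Real.negMulLog x ≤ cfc (fun s => ε - s * Real.log (s + ε)) x := by
    refine cfc_mono (fun s hs => ?_) (by fun_prop) (by fun_prop)
    have hs0 := spectrum_nonneg_of_nonneg hx hs
    rcases hs0.eq_or_lt with rfl | hs1
    · simp [hε.le]
    · have h1 : Real.log (s + ε) - Real.log s ≤ ε / s := by
        rw [← Real.log_div (by positivity) hs1.ne']
        refine (Real.log_le_sub_one_of_pos (by positivity)).trans (le_of_eq ?_)
        field_simp
        ring
      have h2 := mul_le_mul_of_nonneg_left h1 hs0
      rw [mul_div_cancel₀ _ hs1.ne'] at h2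
      rw [Real.negMulLog]
      linarith
  refine (ht.mono h).trans (le_of_eq ?_)
  rw [cfc_sub (fun _ => ε) (fun s => s * Real.log (s + ε)) x (by fun_prop) (by fun_prop),
    cfc_const ε x, map_sub, ht.map_algebraMap, mul_regLog hx hε]

theorem le_cfc_negMulLog (ht : IsRealTrace t) {x : A} (hx : 0 ≤ x) {ε : ℝ} (hε : 0 < ε) :
    - t (x * regLog ε x) ≤ t (cfc Real.negMulLog x) := by
  have hc := continuousOn_log_add hx hε
  rw [mul_regLog hx hε, ← map_neg, ← cfc_neg]
  refine ht.mono (cfc_mono (fun s hs => ?_) (by fun_prop) (by fun_prop))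
  have hs0 := spectrum_nonneg_of_nonneg hx hs
  rcases hs0.eq_or_lt with rfl | hs1
  · simp
  · have h1 : Real.log s ≤ Real.log (s + ε) := Real.log_le_log hs1 (by linarith)
    have h2 := mul_le_mul_of_nonneg_left h1 hs0
    rw [Real.negMulLog]
    linarith

theorem map_mul_mono (ht : IsRealTrace t) {a b c : A} (ha : 0 ≤ a) (hbc : b ≤ c) :
    t (a * b) ≤ t (a * c) := by
  obtain ⟨s, rfl⟩ := CStarAlgebra.nonneg_iff_eq_star_mul_self.mp ha
  have e : ∀ z : A, t (star s * s * z) = t (s * z * star s) := fun z => by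
    rw [mul_assoc, ht.tracial]
  rw [e, e]
  exact ht.mono (star_right_conjugate_le_conjugate hbc s)

/-- Klein's inequality for `a = log (y + ε)` and `b = log (c (x + ε))`. The last term collects the
contributions of the shift by `ε`, estimated by `t(a) ≤ t(y)` (where `ε ≤ 1` enters) and `t(log (x +
ε)) ≥ log ε`; it tends to `0` with `ε`. -/
theorem neg_map_mul_regLog_le (ht : IsRealTrace t) {x y : A} (hx : 0 ≤ x) (hy : 0 ≤ y) {c ε : ℝ}
    (hc : 0 < c) (hε : 0 < ε) (hε1 : ε ≤ 1) :
    - t (y * regLog ε y) ≤ - t (y * regLog ε x) + (- t y * Real.log c + c * t x - t y)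
      + ε * (t y - Real.log ε - Real.log c + c - 1) := by
  set a := regLog ε y with ha
  set b := regLog ε x + algebraMap ℝ A (Real.log c) with hb
  have hasa : IsSelfAdjoint a := isSelfAdjoint_regLog ε
  have hbsa : IsSelfAdjoint b := (isSelfAdjoint_regLog ε).add (IsSelfAdjoint.algebraMap A (.all _))
  have hexpa : NormedSpace.exp a = y + algebraMap ℝ A ε := exp_regLog hy hε
  have hexpb : NormedSpace.exp b = c • (x + algebraMap ℝ A ε) := by
    let : NormedAlgebra ℚ A := .restrictScalars ℚ ℝ A
    rw [hb, NormedSpace.exp_add_of_commute (Algebra.commute_algebraMap_right _ _),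
      exp_regLog hx hε, ← NormedSpace.algebraMap_exp_comm, ← Real.exp_eq_exp_ℝ, Real.exp_log hc,
      ← Algebra.commutes, Algebra.smul_def]
  have hk := ht.klein_exp hasa hbsa
  rw [hexpa, hexpb, add_mul, mul_sub, map_add, map_sub, ← Algebra.smul_def, map_smul, map_sub,
    map_smul, map_add, map_add, ht.map_algebraMap, smul_eq_mul, smul_eq_mul, hb, mul_add,
    map_add, map_mul_algebraMap, map_add, ht.map_algebraMap] at hk
  have hay : t a ≤ t y := by
    refine ht.mono ?_
    conv_rhs => rw [← cfc_id' ℝ y]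
    refine cfc_mono (fun s hs => ?_) (continuousOn_log_add hy hε) (by fun_prop)
    have hs0 := spectrum_nonneg_of_nonneg hy hs
    linarith [Real.log_le_sub_one_of_pos (show 0 < s + ε by positivity)]
  have hxl : Real.log ε ≤ t (regLog ε x) := by
    rw [← ht.map_algebraMap (Real.log ε)]
    refine ht.mono ?_
    refine algebraMap_le_cfc _ _ x (fun s hs => ?_) (continuousOn_log_add hx hε)
    have hs0 := spectrum_nonneg_of_nonneg hx hs
    exact Real.log_le_log hε (by linarith)
  nlinarith [mul_le_mul_of_nonneg_left hay hε.le, mul_le_mul_of_nonneg_left hxl hε.le]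

end Order

/-- Entropy increases under a completely positive map with Kraus operators `w g` by at most the
entropy of the weights of these. -/
theorem entropy_kraus_le (ht : IsRealTrace t) {ι : Type*} [Fintype ι] (w : ι → A) {c : ι → ℝ}
    (hc : ∀ g, 0 < c g) :
    t (cfc Real.negMulLog (∑ g, star (w g) * w g)) ≤
      t (cfc Real.negMulLog (∑ g, w g * star (w g))) +
        ∑ g, (- t (w g * star (w g)) * Real.log (c g)
          + c g * t (∑ h, w h * star (w h)) - t (w g * star (w g))) := by
  let := CStarAlgebra.spectralOrder A
  let := CStarAlgebra.spectralOrderedRing A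
  set y : ι → A := fun g => w g * star (w g) with hy
  set z : ι → A := fun g => star (w g) * w g with hz
  change t (cfc Real.negMulLog (∑ g, z g)) ≤ t (cfc Real.negMulLog (∑ g, y g)) +
    ∑ g, (- t (y g) * Real.log (c g) + c g * t (∑ h, y h) - t (y g))
  have hy0 : ∀ g, 0 ≤ y g := fun g => mul_star_self_nonneg _
  have hz0 : ∀ g, 0 ≤ z g := fun g => star_mul_self_nonneg _
  set x := ∑ g, y g with hx
  set Z := ∑ g, z g with hZ
  have hx0 : 0 ≤ x := Finset.sum_nonneg fun g _ => hy0 g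
  have hZ0 : 0 ≤ Z := Finset.sum_nonneg fun g _ => hz0 g
  let err : ℝ → ℝ := fun ε => ε + ∑ g, ε * (t (y g) - Real.log ε - Real.log (c g) + c g - 1)
  have hmain : ∀ ε : ℝ, 0 < ε → ε ≤ 1 → t (cfc Real.negMulLog Z) ≤ t (cfc Real.negMulLog x) +
      ∑ g, (- t (y g) * Real.log (c g) + c g * t x - t (y g)) + err ε := by
    intro ε hε hε1
    have hsum : ∀ (v : ι → A) (k : A), t ((∑ g, v g) * k) = ∑ g, t (v g * k) := fun v k => by
      rw [Finset.sum_mul, map_sum]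
    have h1 := ht.cfc_negMulLog_le hZ0 hε
    -- Subadditivity: `z g ≤ Z`, and `log` is operator monotone.
    have h2 : ∑ g, - t (z g * regLog ε Z) ≤ ∑ g, - t (z g * regLog ε (z g)) :=
      Finset.sum_le_sum fun g _ => neg_le_neg <| ht.map_mul_mono (hz0 g) <|
        regLog_mono (hz0 g) (Finset.single_le_sum (fun g _ => hz0 g) (Finset.mem_univ g)) hε
    -- `map_cfc_star_mul_self` asks for a function continuous on all of `ℝ`; `|s|` provides this
    -- without changing anything on the spectrum.
    have h3 : ∀ g, t (z g * regLog ε (z g)) = t (y g * regLog ε (y g)) := by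
      intro g
      have hco : Continuous fun s : ℝ => s * Real.log (|s| + ε) := by
        refine continuous_id.mul (Continuous.log (by fun_prop) fun s => ?_)
        positivity
      have e : ∀ v : A, 0 ≤ v → v * regLog ε v = cfc (fun s : ℝ => s * Real.log (|s| + ε)) v := by
        intro v hv
        rw [mul_regLog hv hε]
        refine cfc_congr fun s hs => ?_
        have := spectrum_nonneg_of_nonneg hv hs
        simp [abs_of_nonneg this]
      rw [e _ (hz0 g), e _ (hy0 g)]
      exact ht.map_cfc_star_mul_self (w g) hco
    have h4 : ∑ g, - t (y g * regLog ε (y g)) ≤ ∑ g, (- t (y g * regLog ε x)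
        + (- t (y g) * Real.log (c g) + c g * t x - t (y g))
        + ε * (t (y g) - Real.log ε - Real.log (c g) + c g - 1)) :=
      Finset.sum_le_sum fun g _ => ht.neg_map_mul_regLog_le hx0 (hy0 g) (hc g) hε hε1
    have h5 := ht.le_cfc_negMulLog hx0 hε
    rw [hsum] at h1
    nth_rewrite 1 [hx] at h5
    rw [hsum] at h5
    rw [Finset.sum_add_distrib, Finset.sum_add_distrib] at h4
    simp_rw [h3] at h2
    simp only [Finset.sum_neg_distrib] at h2 h4
    simp only [err]
    linarith
  have herr : Tendsto err (𝓝[>] 0) (𝓝 0) := by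
    -- The singular part `-ε log ε` of the error is `Real.negMulLog ε`, which is continuous with
    -- value `0` at `0`.
    have hc : Continuous fun ε : ℝ =>
        ε + ∑ g, (ε * (t (y g) - Real.log (c g) + c g - 1) + Real.negMulLog ε) := by
      fun_prop
    have h0 := hc.tendsto 0
    simp only [zero_mul, Real.negMulLog_zero, add_zero, Finset.sum_const_zero] at h0
    refine (h0.mono_left nhdsWithin_le_nhds).congr fun ε => ?_
    simp only [err, Real.negMulLog]
    congr 1
    refine Finset.sum_congr rfl fun g _ => ?_
    ring
  have hlim := herr.const_add (t (cfc Real.negMulLog x) +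
      ∑ g, (- t (y g) * Real.log (c g) + c g * t x - t (y g)))
  rw [add_zero] at hlim
  refine ge_of_tendsto hlim ?_
  filter_upwards [Ioc_mem_nhdsGT (show (0 : ℝ) < 1 by norm_num)] with ε hε
  exact hmain ε hε.1 hε.2

end IsRealTrace

end SubfactorEntropy

end

/-! ### Amplification to `ℓ²(ℕ, K)` and the density theorem. -/

noncomputable section

namespace SubfactorEntropy

open Filter Topology

section Amplification

variable {K : Type*} [NormedAddCommGroup K] [InnerProductSpace ℂ K]

/-- The Hilbert space `ℓ²(ℕ, K)`. -/
abbrev Ell2 (K : Type*) [NormedAddCommGroup K] [InnerProductSpace ℂ K] : Type _ :=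
  lp (fun _ : ℕ => K) 2

theorem clm_ext_single {S T : Ell2 K →L[ℂ] Ell2 K}
    (h : ∀ i v, S (lp.single 2 i v) = T (lp.single 2 i v)) : S = T := by
  ext1 f
  have hf := lp.hasSum_single (p := 2) (by simp) f
  refine (S.hasSum hf).unique ?_
  simp_rw [h]
  exact T.hasSum hf

variable [CompleteSpace K]

variable (K) in
/-- The amplification `x ↦ 1 ⊗ x` from `K` to `ℓ²(ℕ, K)`. -/
def amp : (K →L[ℂ] K) →⋆ₐ[ℂ] (Ell2 K →L[ℂ] Ell2 K) where
  toFun x := lp.mapCLM 2 (fun _ => x) (norm_nonneg x) (fun _ => le_rfl)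
  map_one' := by ext; simp
  map_mul' x y := by ext; simp
  map_zero' := by ext; simp
  map_add' x y := by ext; simp
  commutes' c := by ext; simp [Algebra.algebraMap_eq_smul_one]
  map_star' x := by
    refine (ContinuousLinearMap.eq_adjoint_iff _ _).mpr fun f g => ?_
    rw [lp.inner_eq_tsum, lp.inner_eq_tsum]
    refine tsum_congr fun i => ?_
    simp [ContinuousLinearMap.star_eq_adjoint, ContinuousLinearMap.adjoint_inner_left]

@[simp]
theorem amp_apply (x : K →L[ℂ] K) (f : Ell2 K) (i : ℕ) : amp K x f i = x (f i) := by
  simp [amp]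

theorem amp_single (x : K →L[ℂ] K) (i : ℕ) (v : K) :
    amp K x (lp.single 2 i v) = lp.single 2 i (x v) := by
  ext j
  rw [amp_apply]
  by_cases h : j = i
  · subst h; simp
  · simp [h]

theorem inner_amp_left (x : K →L[ℂ] K) (f g : Ell2 K) :
    inner ℂ (amp K x f) g = inner ℂ f (amp K (star x) g) := by
  rw [map_star, ContinuousLinearMap.star_eq_adjoint, ContinuousLinearMap.adjoint_inner_right]

/-- The density theorem: on a vector of `ℓ²(ℕ, K)`, an element of the double commutant of a
`*`-algebra of operators on `K` is approximated by elements of the algebra. -/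
theorem amp_mem_closure_of_mem_centralizer_centralizer (A : StarSubalgebra ℂ (K →L[ℂ] K))
    {x : K →L[ℂ] K} (hx : ∀ y : K →L[ℂ] K, (∀ a ∈ A, a * y = y * a) → y * x = x * y) (f : Ell2 K) :
    amp K x f ∈ closure ((fun a => amp K a f) '' (A : Set (K →L[ℂ] K))) := by
  let ev : (K →L[ℂ] K) →ₗ[ℂ] Ell2 K :=
    { toFun := fun a => amp K a f
      map_add' := fun a b => by simp
      map_smul' := fun c a => by simp }
  -- `W` is the closure of `A f`. It is invariant under the amplified `*`-algebra, so its projection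
  -- commutes with that algebra.
  let W₀ : Submodule ℂ (Ell2 K) := (Subalgebra.toSubmodule A.toSubalgebra).map ev
  let W := W₀.topologicalClosure
  have hW : (W : Set (Ell2 K)) = closure ((fun a => amp K a f) '' (A : Set (K →L[ℂ] K))) := rfl
  have hWc : IsClosed (W : Set (Ell2 K)) := Submodule.isClosed_topologicalClosure _
  have : CompleteSpace W := hWc.completeSpace_coe
  have hinv : ∀ a ∈ A, ∀ w ∈ W, amp K a w ∈ W := by
    intro a ha w hw
    refine map_mem_closure (amp K a).continuous hw ?_
    rintro _ ⟨b, hb, rfl⟩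
    refine ⟨a * b, (mul_mem (show a ∈ A from ha) (show b ∈ A from hb) : a * b ∈ A), ?_⟩
    change amp K (a * b) f = amp K a (amp K b f)
    rw [map_mul]; rfl
  have hcomm : ∀ a ∈ A, ∀ g, amp K a (W.starProjection g) = W.starProjection (amp K a g) := by
    intro a ha g
    symm
    refine Submodule.eq_starProjection_of_mem_of_inner_eq_zero
      (hinv a ha _ (W.starProjection_apply_mem g)) fun w hw => ?_
    rw [← map_sub, inner_amp_left]
    exact W.starProjection_inner_eq_zero g _ (hinv _ (star_mem ha) w hw)
  -- The matrix entries of the projection commute with `A`, hence with `x`. So the projection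
  -- commutes with the amplification of `x`, and `x f` stays in `W` because `f` lies in `W`.
  let P : ℕ → ℕ → K →L[ℂ] K := fun i j =>
    (lp.evalCLM ℂ (fun _ : ℕ => K) 2 i) ∘L W.starProjection ∘L
      (lp.singleContinuousLinearMap ℂ (fun _ : ℕ => K) 2 j)
  have hP : ∀ i j v, P i j v = W.starProjection (lp.single 2 j v) i := fun i j v => rfl
  have hPx : ∀ i j, P i j * x = x * P i j := by
    intro i j
    refine hx _ fun a ha => ?_
    ext v
    simp only [mul_apply_eq_comp, hP]
    rw [← amp_apply, hcomm a ha, amp_single]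
  have hPamp : amp K x * W.starProjection = W.starProjection * amp K x := by
    refine clm_ext_single fun j v => ?_
    ext i
    have := congrArg (fun T : K →L[ℂ] K => T v) (hPx i j)
    simp only [mul_apply_eq_comp, hP] at this ⊢
    rw [amp_apply, amp_single]
    exact this.symm
  have hfW : f ∈ W := subset_closure ⟨1, one_mem A, by change amp K 1 f = f; rw [map_one]; rfl⟩
  have h1 := congrArg (fun T : Ell2 K →L[ℂ] Ell2 K => T f) hPamp
  simp only [mul_apply_eq_comp] at h1
  rw [(Submodule.starProjection_eq_self_iff).mpr hfW] at h1
  rw [← hW]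
  change amp K x f ∈ W
  rw [h1]
  exact W.starProjection_apply_mem _

/-- The vectors on which a bounded sequence of operators is Cauchy form a closed subspace. -/
theorem cauchySeq_apply_of_mem_closure {E F : Type*} [NormedAddCommGroup E] [NormedSpace ℂ E]
    [NormedAddCommGroup F] [NormedSpace ℂ F] {a : ℕ → E →L[ℂ] F} {R : ℝ} (hR : ∀ n, ‖a n‖ ≤ R)
    {s : Set E} (hs : ∀ v ∈ s, CauchySeq fun n => a n v) {v : E}
    (hv : v ∈ (Submodule.span ℂ s).topologicalClosure) : CauchySeq fun n => a n v := by
  have hspan : ∀ v ∈ Submodule.span ℂ s, CauchySeq fun n => a n v := by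
    intro v hv
    induction hv using Submodule.span_induction with
    | mem v hv => exact hs v hv
    | zero => simpa using cauchySeq_const (0 : F)
    | add v w _ _ h1 h2 => simpa using! h1.add h2
    | smul c v _ h => simpa using! (uniformContinuous_const_smul c).comp_cauchySeq h
  rw [Metric.cauchySeq_iff']
  intro ε hε
  have hR0 : 0 ≤ R := (norm_nonneg _).trans (hR 0)
  obtain ⟨w, hw, hvw⟩ := Metric.mem_closure_iff.mp hv (ε / (3 * (R + 1))) (by positivity)
  obtain ⟨m, hm⟩ := Metric.cauchySeq_iff'.mp (hspan w hw) (ε / 3) (by positivity)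
  refine ⟨m, fun n hn => ?_⟩
  have hd : ∀ n, dist (a n v) (a n w) < ε / 3 := by
    intro n
    rw [dist_eq_norm, ← map_sub]
    rw [dist_eq_norm] at hvw
    calc ‖a n (v - w)‖ ≤ R * ‖v - w‖ := (a n).le_of_opNorm_le (hR n) _
      _ ≤ (R + 1) * ‖v - w‖ := by gcongr; linarith
      _ < (R + 1) * (ε / (3 * (R + 1))) := by gcongr
      _ = ε / 3 := by field_simp
  have h1 := dist_triangle4 (a n v) (a n w) (a m w) (a m v)
  have h2 := hd m
  rw [dist_comm] at h2
  linarith [hd n, hm n hn]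

/-- A bounded strongly convergent sequence of operators has a strongly convergent amplification. -/
theorem tendsto_amp {a : ℕ → K →L[ℂ] K} {R : ℝ} (hR : ∀ n, ‖a n‖ ≤ R) {T : K →L[ℂ] K}
    (h : ∀ v, Tendsto (fun n => a n v) atTop (𝓝 (T v))) (f : Ell2 K) :
    Tendsto (fun n => amp K (a n) f) atTop (𝓝 (amp K T f)) := by
  have hb : ∀ n, ‖amp K (a n)‖ ≤ R := fun n =>
    (lp.norm_mapCLM_le 2 (fun _ => a n) (norm_nonneg _) fun _ => le_rfl).trans (hR n)
  have hc : CauchySeq fun n => amp K (a n) f := by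
    refine cauchySeq_apply_of_mem_closure hb
      (s := {g | ∃ i v, g = lp.single 2 i v}) ?_ ?_
    · rintro _ ⟨i, v, rfl⟩
      simp_rw [amp_single]
      exact ((lp.isometry_single (E := fun _ : ℕ => K) (p := 2) i).uniformContinuous).comp_cauchySeq
        (h v).cauchySeq
    · refine mem_closure_of_tendsto (lp.hasSum_single (p := 2) (by simp) f)
        (Eventually.of_forall fun s => ?_)
      exact Submodule.sum_mem _ fun i _ => Submodule.subset_span ⟨i, f i, rfl⟩
  obtain ⟨g, hg⟩ := cauchySeq_tendsto_of_complete hc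
  have : g = amp K T f := by
    ext i
    have h1 := ((lp.evalCLM ℂ (fun _ : ℕ => K) 2 i).continuous.tendsto g).comp hg
    have h2 : Tendsto (fun n => a n (f i)) atTop (𝓝 (g i)) := by
      refine h1.congr fun n => ?_
      exact amp_apply _ _ _
    rw [amp_apply]
    exact tendsto_nhds_unique h2 (h _)
  rwa [← this]

end Amplification

end SubfactorEntropy

end

/-! ### Tracial von Neumann algebras and the trace norm. -/

noncomputable section

namespace SubfactorEntropy

open Filter Topology

section Tracial

variable {K : Type*} [NormedAddCommGroup K] [InnerProductSpace ℂ K] [CompleteSpace K]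
variable {M : VonNeumannAlgebra K} {τ : Elem M →ₗ[ℂ] ℂ} {Ξ : Ell2 K}

/-- Norm closedness makes `Elem M` a C*-algebra, to which the trace inequalities apply; hence its
use as a local instance. -/
theorem isClosed_coe : IsClosed (M.toStarSubalgebra : Set (K →L[ℂ] K)) := by
  have h : (M.toStarSubalgebra : Set (K →L[ℂ] K)) = Set.centralizer (Set.centralizer (M : Set _)) :=
    (VonNeumannAlgebra.centralizer_centralizer M).symm
  rw [h]
  exact Set.isClosed_centralizer _

attribute [local instance] isClosed_coe

/-- The canonical map of `M` to `ℓ²(ℕ, K)` given by a vector. -/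
def gns (Ξ : Ell2 K) : Elem M →ₗ[ℂ] Ell2 K where
  toFun x := amp K (x : K →L[ℂ] K) Ξ
  map_add' x y := by simp
  map_smul' c x := by simp

theorem gns_apply (x : Elem M) : gns Ξ x = amp K (x : K →L[ℂ] K) Ξ := rfl

theorem gns_mul (x y : Elem M) : gns Ξ (x * y) = amp K (x : K →L[ℂ] K) (gns Ξ y) := by
  simp [gns_apply]

/-- `Ξ` is a vector of `ℓ²(ℕ, K)` which gives the functional `τ`. -/
def Represents (Ξ : Ell2 K) (τ : Elem M →ₗ[ℂ] ℂ) : Prop :=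
  ∀ x : Elem M, τ x = inner ℂ Ξ (gns Ξ x)

/-- The vectors in the normality condition are square summable because `∑ ‖ξ n‖² = τ(1)`. They form
one vector `Ξ` of `ℓ²(ℕ, K)`, and `‖gns Ξ x‖` is the trace norm of `x`. -/
theorem IsFaithfulNormalTracialState.exists_represents (hτ : IsFaithfulNormalTracialState τ) :
    ∃ Ξ : Ell2 K, Represents Ξ τ := by
  obtain ⟨ξ, hξ⟩ := hτ.normal
  have h1 : Summable fun n => ‖ξ n‖ ^ 2 := by
    have h := (hξ 1).summable
    have h' := Complex.hasSum_re (hξ 1)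
    refine h'.summable.congr fun n => ?_
    simpa using! inner_self_eq_norm_sq (𝕜 := ℂ) (ξ n)
  have hmem : Memℓp ξ 2 := by
    refine memℓp_gen ?_
    simpa using h1
  refine ⟨⟨ξ, hmem⟩, fun x => (hξ x).unique ?_⟩
  have := lp.hasSum_inner (𝕜 := ℂ) (⟨ξ, hmem⟩ : Ell2 K) (gns ⟨ξ, hmem⟩ x)
  simpa [gns_apply] using! this

theorem Represents.inner_gns (hΞ : Represents Ξ τ) (x y : Elem M) :
    inner ℂ (gns Ξ x) (gns Ξ y) = τ (star x * y) := by
  rw [hΞ, gns_mul, gns_apply x, inner_amp_left]; rfl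

theorem Represents.norm_gns_sq (hΞ : Represents Ξ τ) (x : Elem M) :
    ‖gns Ξ x‖ ^ 2 = (τ (star x * x)).re := by
  rw [← hΞ.inner_gns, ← inner_self_eq_norm_sq (𝕜 := ℂ)]; rfl

theorem Represents.tendsto (hΞ : Represents Ξ τ) {a : ℕ → Elem M} {T : Elem M}
    (h : Tendsto (fun n => gns Ξ (a n)) atTop (𝓝 (gns Ξ T))) :
    Tendsto (fun n => τ (a n)) atTop (𝓝 (τ T)) := by
  simp_rw [hΞ _]
  exact tendsto_const_nhds.inner h

variable (hτ : IsFaithfulNormalTracialState τ) (hΞ : Represents Ξ τ)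
include hτ

theorem IsFaithfulNormalTracialState.isRealTrace :
    IsRealTrace (Complex.reLm ∘ₗ τ.restrictScalars ℝ) where
  map_one := by simp [hτ.map_one]
  nonneg x := by
    obtain ⟨r, hr, h⟩ := hτ.nonneg x
    simpa [h] using hr
  tracial x y := by simp [hτ.tracial x y]
  map_star x := by
    obtain ⟨Ξ, hΞ⟩ := hτ.exists_represents
    have h : τ (star x) = star (τ x) := by
      have h1 := hΞ.inner_gns x 1
      have h2 := hΞ.inner_gns 1 x
      rw [mul_one] at h1
      rw [star_one, one_mul] at h2
      rw [← h1, ← h2]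
      exact (inner_conj_symm _ _).symm
    simp [h]

include hΞ

theorem gns_injective {x y : Elem M} (h : gns Ξ x = gns Ξ y) : x = y := by
  rw [← sub_eq_zero]
  refine hτ.faithful _ ?_
  rw [← hΞ.inner_gns, map_sub, h, sub_self, inner_zero_left]

theorem eq_one_of_apply_eq {e : Elem M} (h : ∀ i, (e : K →L[ℂ] K) (Ξ i) = Ξ i) : e = 1 := by
  refine gns_injective hτ hΞ ?_
  ext i
  simp [gns_apply, h]

/-- Separating for `M` means cyclic for the commutant: the projection onto this closed span commutes
with `M'`, so it lies in `M`; it fixes all `Ξ i`, so faithfulness makes it `1`. -/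
theorem commutant_span_dense : (Submodule.span ℂ
    {v : K | ∃ b ∈ M.commutant, ∃ i, v = b (Ξ i)}).topologicalClosure = ⊤ := by
  set S : Set K := {v : K | ∃ b ∈ M.commutant, ∃ i, v = b (Ξ i)}
  set W := (Submodule.span ℂ S).topologicalClosure with hW
  have hWc : IsClosed (W : Set K) := Submodule.isClosed_topologicalClosure _
  have : CompleteSpace W := hWc.completeSpace_coe
  have hinv : ∀ b ∈ M.commutant, ∀ v ∈ W, b v ∈ W := by
    intro b hb v hv
    have hmaps : Set.MapsTo b (Submodule.span ℂ S) (Submodule.span ℂ S) := by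
      intro v hv
      induction hv using Submodule.span_induction with
      | mem v hv =>
        obtain ⟨c, hc, i, rfl⟩ := hv
        exact Submodule.subset_span ⟨b * c, mul_mem hb hc, i, rfl⟩
      | zero => simp
      | add v w _ _ h1 h2 => rw [map_add]; exact add_mem h1 h2
      | smul c v _ h => rw [map_smul]; exact Submodule.smul_mem _ c h
    exact map_mem_closure b.continuous hv hmaps
  have hmem : W.starProjection ∈ M := by
    rw [VonNeumannAlgebra.IsStarProjection.mem_iff isStarProjection_starProjection]
    intro b hb
    rw [Submodule.range_starProjection]
    exact hinv b hb
  have h1 : (⟨W.starProjection, hmem⟩ : Elem M) = 1 := by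
    refine eq_one_of_apply_eq hτ hΞ fun i => ?_
    refine Submodule.starProjection_eq_self_iff.mpr ?_
    exact subset_closure (Submodule.subset_span ⟨1, one_mem _, i, rfl⟩)
  rw [eq_top_iff]
  intro v _
  have h2 : W.starProjection v = v := congrArg (fun T : Elem M => (T : K →L[ℂ] K) v) h1
  rw [← h2]
  exact W.starProjection_apply_mem v

/-- The balls of a tracial von Neumann algebra are complete for the trace norm, and convergence
there is strong. -/
theorem exists_tendsto_of_cauchySeq {a : ℕ → Elem M} {R : ℝ} (hR : ∀ n, ‖a n‖ ≤ R)
    (ha : CauchySeq fun n => gns Ξ (a n)) :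
    ∃ T : Elem M, ‖T‖ ≤ R ∧ Tendsto (fun n => gns Ξ (a n)) atTop (𝓝 (gns Ξ T)) ∧
      ∀ v, Tendsto (fun n => (a n : K →L[ℂ] K) v) atTop (𝓝 ((T : K →L[ℂ] K) v)) := by
  have hR0 : 0 ≤ R := (norm_nonneg _).trans (hR 0)
  have hcomm : ∀ b ∈ M.commutant, ∀ (x : Elem M) (v : K),
      (x : K →L[ℂ] K) (b v) = b ((x : K →L[ℂ] K) v) := by
    intro b hb x v
    have := VonNeumannAlgebra.mem_commutant_iff.mp hb x x.2
    exact congrArg (fun T : K →L[ℂ] K => T v) this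
  -- For `b` in the commutant, `a n (b (Ξ i)) = b (a n (Ξ i))` is Cauchy. Such vectors are total and
  -- the sequence is bounded, so it is strongly Cauchy.
  have hC : ∀ v, CauchySeq fun n => (a n : K →L[ℂ] K) v := by
    intro v
    refine cauchySeq_apply_of_mem_closure (R := R) hR
      (s := {v : K | ∃ b ∈ M.commutant, ∃ i, v = b (Ξ i)}) ?_ ?_
    · rintro _ ⟨b, hb, i, rfl⟩
      have h := (lp.evalCLM ℂ (fun _ : ℕ => K) 2 i).uniformContinuous.comp_cauchySeq ha
      have e : (fun n => (a n : K →L[ℂ] K) (b (Ξ i))) =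
          fun n => b (lp.evalCLM ℂ (fun _ : ℕ => K) 2 i (gns Ξ (a n))) :=
        funext fun n => (hcomm b hb _ _).trans (congrArg b (amp_apply _ _ _).symm)
      exact (congrArg CauchySeq e).mpr (b.uniformContinuous.comp_cauchySeq h)
    · rw [commutant_span_dense hτ hΞ]; trivial
  choose L hL using fun v => cauchySeq_tendsto_of_complete (hC v)
  let T₀ : K →ₗ[ℂ] K :=
    { toFun := L
      map_add' := fun v w => tendsto_nhds_unique (hL _) (by simpa using (hL v).add (hL w))
      map_smul' := fun c v => tendsto_nhds_unique (hL _) (by simpa using (hL v).const_smul c) }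
  have hb : ∀ v, ‖T₀ v‖ ≤ R * ‖v‖ := fun v =>
    le_of_tendsto (hL v).norm (Eventually.of_forall fun n =>
      (a n : K →L[ℂ] K).le_of_opNorm_le (hR n) v)
  let T : K →L[ℂ] K := T₀.mkContinuous R hb
  have hTL : ∀ v, Tendsto (fun n => (a n : K →L[ℂ] K) v) atTop (𝓝 (T v)) := hL
  have hT : T ∈ M := by
    rw [← VonNeumannAlgebra.commutant_commutant M, VonNeumannAlgebra.mem_commutant_iff]
    intro b hb
    ext v
    refine tendsto_nhds_unique ((b.continuous.tendsto _).comp (hTL v)) ?_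
    refine (hTL (b v)).congr fun n => ?_
    exact hcomm b hb _ _
  have hnorm : ‖T‖ ≤ R := LinearMap.mkContinuous_norm_le _ hR0 _
  have hamp := tendsto_amp (a := fun n => (a n : K →L[ℂ] K)) hR hTL Ξ
  exact ⟨⟨T, hT⟩, hnorm, hamp, hTL⟩

end Tracial

end SubfactorEntropy

end

/-! ### Averaging over the unitary group and uniqueness of the trace. -/

noncomputable section

namespace SubfactorEntropy

attribute [local instance] isClosed_coe

open Filter Topology

/-- The point of least norm in a convex set is unique, so it is fixed by every norm-preserving map
of the set into itself. -/
theorem eq_of_minimal_norm {E : Type*} [NormedAddCommGroup E] [InnerProductSpace ℂ E]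
    {S : Set E} (hS : Convex ℝ S) {p q : E} (hp : p ∈ S) (hq : q ∈ S)
    (hmin : ‖(0 : E) - p‖ = ⨅ w : S, ‖(0 : E) - w‖) (hpq : ‖q‖ = ‖p‖) : q = p := by
  let : InnerProductSpace ℝ E := InnerProductSpace.rclikeToReal ℂ E
  have h := (norm_eq_iInf_iff_real_inner_le_zero hS hp).mp hmin q hq
  rw [zero_sub, inner_neg_left, inner_sub_right, real_inner_self_eq_norm_sq] at h
  have h2 := norm_sub_sq_real p q
  rw [hpq] at h2
  have h3 : ‖p - q‖ ^ 2 = 0 := le_antisymm (by linarith) (by positivity)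
  exact (sub_eq_zero.mp (norm_eq_zero.mp (pow_eq_zero_iff two_ne_zero |>.mp h3))).symm

section TwistedHull

variable {A : Type*} [CStarAlgebra A]

/-- The convex hull of the elements `u a β(u)*` with `u` unitary. -/
def twistedHull (β : A →⋆ₐ[ℂ] A) (a : A) : Set (A) :=
  convexHull ℝ (Set.range fun u : unitary (A) => (u : A) * a * star (β u))

theorem mem_twistedHull_self (β : A →⋆ₐ[ℂ] A) (a : A) : a ∈ twistedHull β a :=
  subset_convexHull ℝ _ ⟨1, by simp⟩

theorem norm_le_of_mem_twistedHull {β : A →⋆ₐ[ℂ] A} {a c : A}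
    (hc : c ∈ twistedHull β a) : ‖c‖ ≤ ‖a‖ := by
  rw [← mem_closedBall_zero_iff]
  refine convexHull_min ?_ (convex_closedBall 0 ‖a‖) hc
  rintro _ ⟨u, rfl⟩
  rw [mem_closedBall_zero_iff]
  change ‖(u : A) * a * star (β u)‖ ≤ ‖a‖
  rw [← map_star]
  refine (norm_mul_le _ _).trans ?_
  have h1 : ‖β (star (u : A))‖ ≤ 1 := by
    refine (NonUnitalStarAlgHom.norm_apply_le β _).trans ?_
    rw [norm_star]
    rcases subsingleton_or_nontrivial A with h | h
    · rw [Subsingleton.elim (u : A) 0, norm_zero]; exact zero_le_one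
    · exact (CStarRing.norm_coe_unitary u).le
  calc ‖(u : A) * a‖ * ‖β (star (u : A))‖ ≤ ‖(u : A) * a‖ * 1 := by gcongr
    _ = ‖a‖ := by rw [mul_one, CStarRing.norm_coe_unitary_mul]

theorem conj_mem_twistedHull {β : A →⋆ₐ[ℂ] A} {a c : A}
    (hc : c ∈ twistedHull β a) (w : unitary (A)) :
    (w : A) * c * star (β w) ∈ twistedHull β a := by
  have hconv : Convex ℝ ((fun c : A => (w : A) * c * star (β w)) ⁻¹' twistedHull β a) := by
    let F : A →ₗ[ℝ] A :=
      { toFun := fun c => (w : A) * c * star (β w)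
        map_add' := fun x y => by rw [mul_add, add_mul]
        map_smul' := fun r x => by simp }
    exact (convex_convexHull ℝ _).linear_preimage F
  refine convexHull_min ?_ hconv hc
  rintro _ ⟨u, rfl⟩
  refine subset_convexHull ℝ _ ⟨w * u, ?_⟩
  simp [mul_assoc]

theorem apply_eq_of_mem_twistedHull {β : A →⋆ₐ[ℂ] A} {a c : A}
    (hc : c ∈ twistedHull β a) (φ : A →ₗ[ℂ] ℂ)
    (h : ∀ u : unitary (A), φ ((u : A) * a * star (β u)) = φ a) : φ c = φ a := by
  have hconv : Convex ℝ {c | φ c = φ a} := by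
    have := (convex_singleton (𝕜 := ℝ) (φ a)).linear_preimage (φ.restrictScalars ℝ)
    exact this
  refine convexHull_min ?_ hconv hc
  rintro _ ⟨u, rfl⟩
  exact h u

theorem star_mul_unitary (β : A →⋆ₐ[ℂ] A) (w : unitary (A)) :
    star (β w) * β w = 1 := by
  rw [← map_star, ← map_mul, Unitary.coe_star_mul_self, map_one]

end TwistedHull

section Averaging

variable {K : Type*} [NormedAddCommGroup K] [InnerProductSpace ℂ K] [CompleteSpace K]
variable {M : VonNeumannAlgebra K} {τ : Elem M →ₗ[ℂ] ℂ} {Ξ : Ell2 K}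

variable (hτ : IsFaithfulNormalTracialState τ) (hΞ : Represents Ξ τ)
include hτ hΞ

theorem norm_gns_conj (β : Elem M →⋆ₐ[ℂ] Elem M) (w : unitary (Elem M)) (x : Elem M) :
    ‖gns Ξ ((w : Elem M) * x * star (β w))‖ = ‖gns Ξ x‖ := by
  rw [← sq_eq_sq₀ (norm_nonneg _) (norm_nonneg _), hΞ.norm_gns_sq, hΞ.norm_gns_sq]
  have e : star ((w : Elem M) * x * star (β w)) * ((w : Elem M) * x * star (β w))
      = β w * (star x * x * star (β w)) := by
    simp only [star_mul, star_star, mul_assoc]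
    rw [← mul_assoc (star (w : Elem M)), Unitary.coe_star_mul_self, one_mul]
  rw [e, hτ.tracial, mul_assoc, star_mul_unitary, mul_one]

/-- The trace norm closure of the twisted hull of `a` contains an element which is invariant under
the twisted action of the unitary group. -/
theorem exists_twisted_invariant (β : Elem M →⋆ₐ[ℂ] Elem M) (a : Elem M) :
    ∃ (T : Elem M) (c : ℕ → Elem M), (∀ n, c n ∈ twistedHull β a) ∧ ‖T‖ ≤ ‖a‖ ∧
      Tendsto (fun n => gns Ξ (c n)) atTop (𝓝 (gns Ξ T)) ∧
      (∀ v, Tendsto (fun n => (c n : K →L[ℂ] K) v) atTop (𝓝 ((T : K →L[ℂ] K) v))) ∧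
      ∀ x : Elem M, x * T = T * β x := by
  set S : Set (Ell2 K) := closure (gns Ξ '' twistedHull β a) with hS
  have hconv : Convex ℝ S := by
    refine Convex.closure ?_
    exact (convex_convexHull ℝ _).linear_image ((gns Ξ : Elem M →ₗ[ℂ] Ell2 K).restrictScalars ℝ)
  have hne : S.Nonempty := ⟨_, subset_closure ⟨a, mem_twistedHull_self β a, rfl⟩⟩
  -- The invariant element is the point of least trace norm: each map `x ↦ w x β(w)*` is isometric
  -- and preserves the closed hull.
  obtain ⟨p, hpS, hp⟩ : ∃ p ∈ S, ‖(0 : Ell2 K) - p‖ = ⨅ w : S, ‖(0 : Ell2 K) - w‖ := by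
    let : InnerProductSpace ℝ (Ell2 K) := InnerProductSpace.rclikeToReal ℂ (Ell2 K)
    exact exists_norm_eq_iInf_of_complete_convex hne isClosed_closure.isComplete hconv 0
  obtain ⟨y, hy, hylim⟩ := mem_closure_iff_seq_limit.mp hpS
  choose c hc hcy using hy
  have hJ : Tendsto (fun n => gns Ξ (c n)) atTop (𝓝 p) := by simpa [hcy] using hylim
  obtain ⟨T, hTa, hT, hTv⟩ := exists_tendsto_of_cauchySeq hτ hΞ
    (fun n => norm_le_of_mem_twistedHull (hc n)) hJ.cauchySeq
  have hTp : gns Ξ T = p := tendsto_nhds_unique hT hJ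
  refine ⟨T, c, hc, hTa, hT, hTv, ?_⟩
  have hinv : ∀ w : unitary (Elem M), (w : Elem M) * T * star (β w) = T := by
    intro w
    refine gns_injective hτ hΞ ?_
    rw [hTp]
    have hmem : gns Ξ ((w : Elem M) * T * star (β w)) ∈ S := by
      refine mem_closure_of_tendsto (f := fun n => gns Ξ ((w : Elem M) * c n * star (β w)))
        (b := atTop) ?_ (Eventually.of_forall fun n =>
          ⟨_, conj_mem_twistedHull (hc n) w, rfl⟩)
      rw [tendsto_iff_norm_sub_tendsto_zero] at hT ⊢
      refine hT.congr fun n => ?_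
      rw [← map_sub, ← map_sub, ← sub_mul, ← mul_sub, norm_gns_conj hτ hΞ]
    refine eq_of_minimal_norm hconv hpS hmem hp ?_
    rw [norm_gns_conj hτ hΞ, hTp]
  have hunit : ∀ w : unitary (Elem M), (w : Elem M) * T = T * β w := by
    intro w
    conv_rhs => rw [← hinv w, mul_assoc, star_mul_unitary, mul_one]
  intro x
  -- Invariance under unitaries extends to all of `M`, which they span.
  have hx : x ∈ Submodule.span ℂ (unitary (Elem M) : Set (Elem M)) := by
    rw [CStarAlgebra.span_unitary]; trivial
  induction hx using Submodule.span_induction with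
  | mem x hx => exact hunit ⟨x, hx⟩
  | zero => simp
  | add x y _ _ h1 h2 => rw [add_mul, h1, h2, map_add, mul_add]
  | smul r x _ h => rw [smul_mul_assoc, h, map_smul, mul_smul_comm]

/-- On a factor, the trace is the only tracial state which is continuous on bounded sets for the
trace norm. -/
theorem IsFactor.trace_unique (hM : IsFactor M) (φ : Elem M →ₗ[ℂ] ℂ) (h1 : φ 1 = 1)
    (htr : ∀ x y, φ (x * y) = φ (y * x))
    (hφ : ∀ (R : ℝ) (q : ℕ → Elem M), (∀ n, ‖q n‖ ≤ R) →
      Tendsto (fun n => gns Ξ (q n)) atTop (𝓝 0) → Tendsto (fun n => φ (q n)) atTop (𝓝 0))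
    (a : Elem M) : φ a = τ a := by
  -- For `β = id` the invariant element is central, hence a scalar `k`. Tracial functionals are
  -- constant on the hull of `a`, so both `τ` and `φ` take the value `k` at `a`.
  obtain ⟨T, c, hc, hTa, hT, -, hcomm⟩ := exists_twisted_invariant hτ hΞ (StarAlgHom.id ℂ _) a
  obtain ⟨k, rfl⟩ := hM T fun x => (hcomm x).symm
  have hconst : ∀ ψ : Elem M →ₗ[ℂ] ℂ, (∀ x y, ψ (x * y) = ψ (y * x)) → ∀ n, ψ (c n) = ψ a := by
    intro ψ hψ n
    refine apply_eq_of_mem_twistedHull (hc n) ψ fun u => ?_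
    rw [hψ, ← mul_assoc]
    simp
  have e1 : τ a = k := by
    have := hΞ.tendsto hT
    simp_rw [hconst τ hτ.tracial] at this
    simpa [hτ.map_one] using tendsto_nhds_unique tendsto_const_nhds this
  have e2 : φ a = k := by
    have := hφ (‖a‖ + ‖a‖) (fun n => c n - k • 1)
      (fun n => (norm_sub_le _ _).trans
        (add_le_add (norm_le_of_mem_twistedHull (hc n)) hTa))
      (by
        have h := hT.sub_const (gns Ξ (k • (1 : Elem M)))
        rw [sub_self] at h
        simpa only [map_sub] using h)
    simp_rw [map_sub, hconst φ htr] at this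
    have h := tendsto_nhds_unique this tendsto_const_nhds
    rw [map_smul, h1, smul_eq_mul, mul_one] at h
    exact sub_eq_zero.mp h.symm
  rw [e1, e2]

end Averaging

end SubfactorEntropy

end

/-! ### Automorphisms: continuity for the trace norm and invariance of the trace. -/

noncomputable section

namespace SubfactorEntropy

attribute [local instance] isClosed_coe

open Filter Topology

section Normal

variable {K : Type*} [NormedAddCommGroup K] [InnerProductSpace ℂ K] [CompleteSpace K]
variable {M : VonNeumannAlgebra K} {τ : Elem M →ₗ[ℂ] ℂ} {Ξ : Ell2 K}

theorem exists_eq_mul_self {x : Elem M} (hx : 0 ≤ (x : K →L[ℂ] K)) :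
    ∃ s : Elem M, star s = s ∧ x = s * s := by
  have hs : IsSelfAdjoint (cfc Real.sqrt (x : K →L[ℂ] K)) := cfc_predicate _ _
  refine ⟨⟨cfc Real.sqrt (x : K →L[ℂ] K), cfc_mem _ _⟩, Subtype.ext hs, Subtype.ext ?_⟩
  change (x : K →L[ℂ] K) = cfc Real.sqrt (x : K →L[ℂ] K) * cfc Real.sqrt (x : K →L[ℂ] K)
  rw [← cfc_mul Real.sqrt Real.sqrt (x : K →L[ℂ] K)]
  conv_lhs => rw [← cfc_id' ℝ (x : K →L[ℂ] K)]
  refine cfc_congr fun s hs => ?_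
  exact (Real.mul_self_sqrt (spectrum_nonneg_of_nonneg hx hs)).symm

theorem exists_eq_star_mul_self {x : Elem M} (hx : 0 ≤ (x : K →L[ℂ] K)) :
    ∃ s : Elem M, x = star s * s := by
  obtain ⟨s, hs, h⟩ := exists_eq_mul_self hx
  exact ⟨s, by rw [hs, h]⟩

theorem coe_star_mul_self_nonneg (s : Elem M) : 0 ≤ ((star s * s : Elem M) : K →L[ℂ] K) :=
  star_mul_self_nonneg (s : K →L[ℂ] K)

theorem starAlgHom_mono {L : Type*} [NormedAddCommGroup L] [InnerProductSpace ℂ L] [CompleteSpace L]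
    {P : VonNeumannAlgebra L} {F : Type*} [FunLike F (Elem M) (Elem P)]
    [AlgHomClass F ℂ (Elem M) (Elem P)] [StarHomClass F (Elem M) (Elem P)] (β : F)
    {x y : Elem M} (h : (x : K →L[ℂ] K) ≤ y) :
    ((β x : Elem P) : L →L[ℂ] L) ≤ (β y : Elem P) := by
  have h1 : 0 ≤ ((y - x : Elem M) : K →L[ℂ] K) := sub_nonneg.mpr h
  obtain ⟨s, hs⟩ := exists_eq_star_mul_self h1
  have h2 := coe_star_mul_self_nonneg (β s)
  rw [← map_star, ← map_mul, ← hs, map_sub] at h2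
  exact sub_nonneg.mp h2

/-- The operator monotone function `1 - (1 + s)⁻¹`, on `M`. -/
def squash (x : Elem M) : Elem M :=
  ⟨cfc (fun s : ℝ => 1 - (1 + s)⁻¹) (x : K →L[ℂ] K), cfc_mem _ _⟩

theorem continuousOn_squash {x : K →L[ℂ] K} (hx : 0 ≤ x) :
    ContinuousOn (fun s : ℝ => 1 - (1 + s)⁻¹) (spectrum ℝ x) := by
  refine continuousOn_const.sub (ContinuousOn.inv₀ (by fun_prop) fun s hs => ?_)
  have := spectrum_nonneg_of_nonneg hx hs
  positivity

theorem squash_mono {x y : Elem M} (hx : 0 ≤ (x : K →L[ℂ] K)) (hxy : (x : K →L[ℂ] K) ≤ y) :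
    (squash x : K →L[ℂ] K) ≤ squash y := by
  have h := CFC.monotoneOn_one_sub_one_add_inv_real (A := K →L[ℂ] K) hx (hx.trans hxy) hxy
  have e : ∀ z : K →L[ℂ] K, 0 ≤ z → cfcₙ (fun s : ℝ => 1 - (1 + s)⁻¹) z
      = cfc (fun s : ℝ => 1 - (1 + s)⁻¹) z := fun z hz => by
    refine cfcₙ_eq_cfc ?_ (by simp)
    refine continuousOn_const.sub (ContinuousOn.inv₀ (by fun_prop) fun s hs => ?_)
    have := quasispectrum_nonneg_of_nonneg z hz s hs
    positivity
  simp only [e _ hx, e _ (hx.trans hxy)] at h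
  exact h

theorem squash_nonneg {x : Elem M} (hx : 0 ≤ (x : K →L[ℂ] K)) : 0 ≤ (squash x : K →L[ℂ] K) := by
  refine cfc_nonneg fun s hs => ?_
  have := spectrum_nonneg_of_nonneg hx hs
  rw [sub_nonneg]
  exact inv_le_one_of_one_le₀ (by linarith)

theorem squash_le_one {x : Elem M} (hx : 0 ≤ (x : K →L[ℂ] K)) : (squash x : K →L[ℂ] K) ≤ 1 := by
  refine cfc_le_one _ _ fun s hs => ?_
  have := spectrum_nonneg_of_nonneg hx hs
  have h : (0 : ℝ) ≤ (1 + s)⁻¹ := by positivity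
  linarith

theorem squash_le_self {x : Elem M} (hx : 0 ≤ (x : K →L[ℂ] K)) :
    (squash x : K →L[ℂ] K) ≤ x := by
  conv_rhs => rw [← cfc_id' ℝ (x : K →L[ℂ] K)]
  refine cfc_mono (fun s hs => ?_) (continuousOn_squash hx) (by fun_prop)
  have h0 := spectrum_nonneg_of_nonneg hx hs
  have h1 : 1 - (1 + s)⁻¹ = s * (1 + s)⁻¹ := by field_simp; ring
  rw [h1]
  exact mul_le_of_le_one_right h0 (inv_le_one_of_one_le₀ (by linarith))

/-- On the spectrum, `1 - (1 + s)⁻¹ = s / (1 + s) ≥ s / (1 + R)`. -/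
theorem le_smul_squash {x : Elem M} (hx : 0 ≤ (x : K →L[ℂ] K)) {R : ℝ} (hR : ‖x‖ ≤ R) :
    (x : K →L[ℂ] K) ≤ ((((1 + R : ℝ) : ℂ) • squash x : Elem M) : K →L[ℂ] K) := by
  have e : ((((1 + R : ℝ) : ℂ) • squash x : Elem M) : K →L[ℂ] K)
      = cfc (fun s : ℝ => (1 + R) • (1 - (1 + s)⁻¹)) (x : K →L[ℂ] K) := by
    rw [cfc_smul (1 + R) (fun s : ℝ => (1 - (1 + s)⁻¹)) (x : K →L[ℂ] K) (continuousOn_squash hx)]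
    exact Complex.coe_smul _ _
  rw [e]
  conv_lhs => rw [← cfc_id' ℝ (x : K →L[ℂ] K)]
  have hc := continuousOn_squash hx
  refine cfc_mono (fun s hs => ?_) (by fun_prop) (by fun_prop)
  have h0 := spectrum_nonneg_of_nonneg hx hs
  have h1 : s ≤ R := by
    by_cases hK : Nontrivial (K →L[ℂ] K)
    · exact (le_abs_self s).trans ((spectrum.norm_le_norm_of_mem hs).trans hR)
    · rw [not_nontrivial_iff_subsingleton] at hK
      simp at hs
  have h2 : 1 - (1 + s)⁻¹ = s * (1 + s)⁻¹ := by field_simp; ring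
  rw [smul_eq_mul, h2]
  have h3 : 1 ≤ (1 + R) * (1 + s)⁻¹ := by
    rw [← div_eq_mul_inv, le_div_iff₀ (by positivity)]; linarith
  nlinarith

omit [CompleteSpace K] in
theorem le_of_tendsto_apply {a : ℕ → K →L[ℂ] K} {T b : K →L[ℂ] K}
    (h : ∀ v, Tendsto (fun n => a n v) atTop (𝓝 (T v))) (hb : ∀ᶠ n in atTop, a n ≤ b) : T ≤ b := by
  rw [ContinuousLinearMap.le_def, ContinuousLinearMap.isPositive_iff_complex]
  intro v
  have hlim : Tendsto (fun n => inner ℂ ((b - a n) v) v) atTop (𝓝 (inner ℂ ((b - T) v) v)) :=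
    ((h v).const_sub (b v)).inner tendsto_const_nhds
  have hev : ∀ᶠ n in atTop, ((RCLike.re (inner ℂ ((b - a n) v) v) : ℝ) : ℂ)
      = inner ℂ ((b - a n) v) v ∧ 0 ≤ RCLike.re (inner ℂ ((b - a n) v) v) := by
    filter_upwards [hb] with n hn
    exact (ContinuousLinearMap.isPositive_iff_complex _).mp hn v
  have hre : Tendsto (fun n => RCLike.re (inner ℂ ((b - a n) v) v)) atTop
      (𝓝 (RCLike.re (inner ℂ ((b - T) v) v))) := (RCLike.continuous_re.tendsto _).comp hlim
  refine ⟨tendsto_nhds_unique_of_eventuallyEq ((Complex.continuous_ofReal.tendsto _).comp hre) hlim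
    (hev.mono fun n hn => hn.1), ge_of_tendsto hre (hev.mono fun n hn => hn.2)⟩

theorem ge_of_tendsto_apply {a : ℕ → K →L[ℂ] K} {T b : K →L[ℂ] K}
    (h : ∀ v, Tendsto (fun n => a n v) atTop (𝓝 (T v))) (hb : ∀ᶠ n in atTop, b ≤ a n) : b ≤ T := by
  refine neg_le_neg_iff.mp (le_of_tendsto_apply (a := fun n => - a n) (fun v => (h v).neg) ?_)
  filter_upwards [hb] with n hn
  exact neg_le_neg hn

variable (hτ : IsFaithfulNormalTracialState τ) (hΞ : Represents Ξ τ)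
include hτ

theorem re_trace_nonneg {x : Elem M} (hx : 0 ≤ (x : K →L[ℂ] K)) : 0 ≤ (τ x).re := by
  obtain ⟨s, rfl⟩ := exists_eq_star_mul_self hx
  exact hτ.isRealTrace.nonneg s

theorem re_trace_mono {x y : Elem M} (h : (x : K →L[ℂ] K) ≤ y) : (τ x).re ≤ (τ y).re := by
  have h1 : 0 ≤ ((y - x : Elem M) : K →L[ℂ] K) := sub_nonneg.mpr h
  have := re_trace_nonneg hτ h1
  rw [map_sub, Complex.sub_re] at this
  linarith

theorem eq_zero_of_re_trace_eq_zero {x : Elem M} (hx : 0 ≤ (x : K →L[ℂ] K))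
    (h : (τ x).re = 0) : x = 0 := by
  obtain ⟨s, rfl⟩ := exists_eq_star_mul_self hx
  obtain ⟨r, -, hr⟩ := hτ.nonneg s
  rw [hr, Complex.ofReal_re] at h
  rw [hτ.faithful s (by rw [hr, h, Complex.ofReal_zero]), mul_zero]

include hΞ

/-- An increasing sequence in the unit ball has a supremum, and the trace is continuous along it. -/
theorem exists_isLUB {a : ℕ → Elem M} (h0 : ∀ n, 0 ≤ (a n : K →L[ℂ] K))
    (h1 : ∀ n, (a n : K →L[ℂ] K) ≤ 1) (hmono : Monotone fun n => (a n : K →L[ℂ] K)) :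
    ∃ T : Elem M, (∀ n, (a n : K →L[ℂ] K) ≤ T) ∧
      (∀ b : Elem M, (∀ n, (a n : K →L[ℂ] K) ≤ b) → (T : K →L[ℂ] K) ≤ b) ∧
      Tendsto (fun n => (τ (a n)).re) atTop (𝓝 (τ T).re) := by
  have hnorm : ∀ n, ‖a n‖ ≤ 1 := fun n =>
    (CStarAlgebra.norm_le_one_iff_of_nonneg (a n : K →L[ℂ] K) (h0 n)).mpr (h1 n)
  have ht : Monotone fun n => (τ (a n)).re := fun n m h => re_trace_mono hτ (hmono h)
  have htb : BddAbove (Set.range fun n => (τ (a n)).re) := by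
    refine ⟨1, ?_⟩
    rintro _ ⟨n, rfl⟩
    have := re_trace_mono hτ (x := a n) (y := 1) (h1 n)
    rwa [hτ.map_one] at this
  -- For `0 ≤ d ≤ 1` one has `d² ≤ d`, so squared trace norms of increments are bounded by
  -- increments of the convergent sequence `τ(a n)`.
  have hsq : ∀ n m, n ≤ m → ‖gns Ξ (a m) - gns Ξ (a n)‖ ^ 2 ≤ (τ (a m)).re - (τ (a n)).re := by
    intro n m h
    rw [← map_sub, hΞ.norm_gns_sq, ← Complex.sub_re, ← map_sub]
    refine re_trace_mono hτ ?_
    set d : K →L[ℂ] K := ((a m - a n : Elem M) : K →L[ℂ] K) with hd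
    have hd0 : 0 ≤ d := sub_nonneg.mpr (hmono h)
    have hd1 : d ≤ 1 := (sub_le_self _ (h0 n)).trans (h1 m)
    have hdsa : star d = d := (IsSelfAdjoint.of_nonneg hd0).star_eq
    change star d * d ≤ d
    rw [hdsa, ← sub_nonneg]
    have e : d - d * d = cfc (fun s : ℝ => s - s * s) d := by
      rw [cfc_sub (fun s : ℝ => s) (fun s => s * s) d, cfc_mul (fun s : ℝ => s) (fun s => s) d,
        cfc_id' ℝ d]
    rw [e]
    refine cfc_nonneg fun s hs => ?_
    have hs0 := spectrum_nonneg_of_nonneg hd0 hs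
    have hs1 : s ≤ 1 := (CFC.le_one_iff d).mp hd1 s hs
    nlinarith
  have hC : CauchySeq fun n => gns Ξ (a n) := by
    rw [Metric.cauchySeq_iff']
    intro ε hε
    obtain ⟨N, hN⟩ := Metric.cauchySeq_iff'.mp (tendsto_atTop_ciSup ht htb).cauchySeq (ε ^ 2)
      (by positivity)
    refine ⟨N, fun n hn => ?_⟩
    have h := hN n hn
    rw [Real.dist_eq] at h
    rw [dist_eq_norm]
    refine lt_of_pow_lt_pow_left₀ 2 hε.le ?_
    exact (hsq N n hn).trans_lt ((le_abs_self _).trans_lt h)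
  obtain ⟨T, -, hT, hTv⟩ := exists_tendsto_of_cauchySeq hτ hΞ hnorm hC
  refine ⟨T, fun n => ?_, fun b hb => ?_, ?_⟩
  · refine ge_of_tendsto_apply hTv ?_
    filter_upwards [eventually_ge_atTop n] with m hm
    exact hmono hm
  · exact le_of_tendsto_apply hTv (Eventually.of_forall hb)
  · exact (Complex.continuous_re.tendsto _).comp (hΞ.tendsto hT)

/-- No normality of `β` is assumed; only its order properties are used. Let `c n` be the supremum
over `m` of `squash (p n + ⋯ + p (n + m - 1))`. These decrease, and `τ(c n)` is at most a tail of
the series. If `D` is the supremum of `1 - β(c n)`, then `β⁻¹(1 - D)` lies below every `c n`, so it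
has trace `0` and `D = 1`. Thus `τ(β(c n)) → 0`, and `p n ≤ (1 + R) c n` gives the claim. -/
theorem tendsto_re_trace_of_summable (β : Elem M ≃⋆ₐ[ℂ] Elem M) {p : ℕ → Elem M} {R : ℝ}
    (h0 : ∀ n, 0 ≤ (p n : K →L[ℂ] K)) (hR : ∀ n, ‖p n‖ ≤ R) (hs : Summable fun n => (τ (p n)).re) :
    Tendsto (fun n => (τ (β (p n))).re) atTop (𝓝 0) := by
  have hR0 : 0 ≤ R := (norm_nonneg _).trans (hR 0)
  let S : ℕ → ℕ → Elem M := fun n m => ∑ k ∈ Finset.range m, p (n + k)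
  have hcoe : ∀ n m, ((S n m : Elem M) : K →L[ℂ] K)
      = ∑ k ∈ Finset.range m, (p (n + k) : K →L[ℂ] K) := fun n m => by
    simp [S]
  have hS0 : ∀ n m, 0 ≤ (S n m : K →L[ℂ] K) := fun n m => by
    rw [hcoe]; exact Finset.sum_nonneg fun k _ => h0 _
  have hSmono : ∀ n m m', m ≤ m' → (S n m : K →L[ℂ] K) ≤ S n m' := by
    intro n m m' h
    rw [hcoe, hcoe]
    exact Finset.sum_le_sum_of_subset_of_nonneg (Finset.range_mono h) fun k _ _ => h0 _
  have hSsucc : ∀ n m, (S (n + 1) m : K →L[ℂ] K) ≤ S n (m + 1) := by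
    intro n m
    rw [hcoe, hcoe, Finset.sum_range_succ']
    refine (le_of_eq ?_).trans (le_add_of_nonneg_right (h0 _))
    exact Finset.sum_congr rfl fun k _ => by rw [add_assoc, add_comm 1 k]
  -- The partial sums need not be bounded in norm; `squash` brings them into the unit ball and keeps
  -- them increasing.
  have hsup := fun n => exists_isLUB hτ hΞ (a := fun m => squash (S n m))
    (fun m => squash_nonneg (hS0 n m)) (fun m => squash_le_one (hS0 n m))
    (fun m m' h => squash_mono (hS0 n m) (hSmono n m m' h))
  choose c hcub hclub hclim using hsup
  have hc0 : ∀ n, 0 ≤ (c n : K →L[ℂ] K) := fun n => (squash_nonneg (hS0 n 0)).trans (hcub n 0)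
  have hc1 : ∀ n, (c n : K →L[ℂ] K) ≤ 1 := fun n =>
    hclub n 1 fun m => squash_le_one (hS0 n m)
  have hcanti : Antitone fun n => (c n : K →L[ℂ] K) := antitone_nat_of_succ_le fun n =>
    hclub (n + 1) (c n) fun m =>
      (squash_mono (hS0 _ m) (hSsucc n m)).trans (hcub n (m + 1))
  have hctr : ∀ n, (τ (c n)).re ≤ ∑' k, (τ (p (k + n))).re := by
    intro n
    refine le_of_tendsto (hclim n) (Eventually.of_forall fun m => ?_)
    refine (re_trace_mono hτ (squash_le_self (hS0 n m))).trans ?_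
    have e : (τ (S n m)).re = ∑ k ∈ Finset.range m, (τ (p (k + n))).re := by
      simp [S, map_sum, add_comm]
    rw [e]
    exact ((summable_nat_add_iff n).mpr hs).sum_le_tsum _ fun k _ => re_trace_nonneg hτ (h0 _)
  have hctr0 : Tendsto (fun n => (τ (c n)).re) atTop (𝓝 0) :=
    squeeze_zero (fun n => re_trace_nonneg hτ (hc0 n)) hctr
      (tendsto_sum_nat_add fun k => (τ (p k)).re)
  have hβ0 : ∀ x : Elem M, 0 ≤ (x : K →L[ℂ] K) → 0 ≤ ((β x : Elem M) : K →L[ℂ] K) := fun x hx => by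
    have := starAlgHom_mono β (x := 0) (y := x) hx
    rwa [map_zero] at this
  obtain ⟨D, hDub, hDlub, hDlim⟩ := exists_isLUB hτ hΞ (a := fun n => 1 - β (c n))
    (fun n => by
      have := starAlgHom_mono β (x := c n) (y := 1) (hc1 n)
      rw [map_one] at this
      exact sub_nonneg.mpr this)
    (fun n => sub_le_self _ (hβ0 _ (hc0 n)))
    (fun n m h => sub_le_sub_left (starAlgHom_mono β (hcanti h)) _)
  have hD1 : (D : K →L[ℂ] K) ≤ 1 := hDlub 1 fun n => sub_le_self _ (hβ0 _ (hc0 n))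
  have hE0 : 0 ≤ ((β.symm (1 - D) : Elem M) : K →L[ℂ] K) := by
    have := starAlgHom_mono β.symm (x := 0) (y := 1 - D) (sub_nonneg.mpr hD1)
    rwa [map_zero] at this
  have hEle : ∀ n, ((β.symm (1 - D) : Elem M) : K →L[ℂ] K) ≤ c n := by
    intro n
    have h : ((1 - D : Elem M) : K →L[ℂ] K) ≤ (β (c n) : Elem M) := sub_le_comm.mp (hDub n)
    have := starAlgHom_mono β.symm h
    rwa [StarAlgEquiv.symm_apply_apply] at this
  have hEtr : (τ (β.symm (1 - D))).re = 0 :=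
    le_antisymm (ge_of_tendsto hctr0 (Eventually.of_forall fun n => re_trace_mono hτ (hEle n)))
      (re_trace_nonneg hτ hE0)
  have hD : D = 1 := by
    have h := eq_zero_of_re_trace_eq_zero hτ hE0 hEtr
    have h2 := congrArg β h
    rw [StarAlgEquiv.apply_symm_apply, map_zero, sub_eq_zero] at h2
    exact h2.symm
  have hβc : Tendsto (fun n => (τ (β (c n))).re) atTop (𝓝 0) := by
    have := hDlim.const_sub 1
    simpa [hD, hτ.map_one] using this
  refine squeeze_zero (fun n => re_trace_nonneg hτ (hβ0 _ (h0 n))) (fun n => ?_)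
    (by simpa using hβc.const_mul (1 + R))
  have e1 : (squash (p n) : K →L[ℂ] K) ≤ c n := by
    refine (squash_mono (h0 n) (le_of_eq ?_)).trans (hcub n 1)
    simp [S]
  have e2 := re_trace_mono hτ (starAlgHom_mono β (le_smul_squash (h0 n) (hR n)))
  have e3 := re_trace_mono hτ (starAlgHom_mono β e1)
  rw [map_smul, map_smul, smul_eq_mul, Complex.re_ofReal_mul] at e2
  exact e2.trans (mul_le_mul_of_nonneg_left e3 (by positivity))

/-- Automorphisms are continuous on bounded sets for the trace norm. -/
theorem tendsto_gns_starAlgEquiv (β : Elem M ≃⋆ₐ[ℂ] Elem M) {R : ℝ} {q : ℕ → Elem M}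
    (hR : ∀ n, ‖q n‖ ≤ R) (hq : Tendsto (fun n => gns Ξ (q n)) atTop (𝓝 0)) :
    Tendsto (fun n => gns Ξ (β (q n))) atTop (𝓝 0) := by
  refine tendsto_of_subseq_tendsto fun ns hns => ?_
  have h1 : Tendsto (fun n => ‖gns Ξ (q (ns n))‖ ^ 2) atTop (𝓝 0) := by
    have := ((hq.comp hns).norm).pow 2
    simpa using this
  -- It suffices to treat a subsequence whose squared trace norms are at most `2^{-n}`, hence
  -- summable.
  have hfreq : ∀ n : ℕ, ∃ᶠ k in atTop, ‖gns Ξ (q (ns k))‖ ^ 2 ≤ (1 / 2 : ℝ) ^ n := fun n =>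
    ((h1.eventually_lt_const (show (0 : ℝ) < (1 / 2) ^ n by positivity)).mono
      fun k hk => hk.le).frequently
  obtain ⟨φ, -, hφ⟩ := extraction_forall_of_frequently hfreq
  refine ⟨φ, ?_⟩
  set r : ℕ → Elem M := fun n => q (ns (φ n)) with hr
  have hsum : Summable fun n => (τ (star (r n) * r n)).re := by
    refine Summable.of_nonneg_of_le (fun n => ?_) (fun n => ?_) summable_geometric_two
    · rw [← hΞ.norm_gns_sq]; positivity
    · rw [← hΞ.norm_gns_sq]; exact hφ n
  have hb : ∀ n, ‖star (r n) * r n‖ ≤ R * R := fun n => by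
    refine (norm_mul_le _ _).trans ?_
    rw [norm_star]
    exact mul_le_mul (hR _) (hR _) (norm_nonneg _) ((norm_nonneg _).trans (hR 0))
  have h2 := tendsto_re_trace_of_summable hτ hΞ β (fun n => coe_star_mul_self_nonneg (r n)) hb hsum
  rw [tendsto_zero_iff_norm_tendsto_zero]
  have h3 := h2.sqrt
  rw [Real.sqrt_zero] at h3
  refine h3.congr fun n => ?_
  rw [map_mul, map_star, ← hΞ.norm_gns_sq, Real.sqrt_sq (norm_nonneg _)]

/-- The trace of a factor is invariant under automorphisms. -/
theorem IsFactor.trace_starAlgEquiv (hM : IsFactor M) (β : Elem M ≃⋆ₐ[ℂ] Elem M) (a : Elem M) :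
    τ (β a) = τ a := by
  refine hM.trace_unique hτ hΞ (τ ∘ₗ (β : Elem M →ₗ[ℂ] Elem M)) ?_ ?_ ?_ a
  · simp [hτ.map_one]
  · intro x y
    simp [hτ.tracial (β x)]
  · intro R q hR hq
    have h := hΞ.tendsto (T := 0) (by simpa using tendsto_gns_starAlgEquiv hτ hΞ β hR hq)
    simpa using! h

end Normal

end SubfactorEntropy

end

/-! ### The algebra of finite Fourier series in the crossed product. -/

noncomputable section

namespace SubfactorEntropy

attribute [local instance] isClosed_coe

open Filter Topology

section CrossedProductAlgebra

variable {H : Type*} [NormedAddCommGroup H] [InnerProductSpace ℂ H] [CompleteSpace H]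
variable {N : VonNeumannAlgebra H}
variable {G : Type*} [Group G] [Fintype G]
variable (α : G →* (Elem N ≃⋆ₐ[ℂ] Elem N))

omit [CompleteSpace H] in
theorem transOp_apply (g : G) (ξ : L2 G H) (h : G) : transOp H g ξ h = ξ (g⁻¹ * h) := rfl

theorem implementer_one : implementer α (1 : G) = 1 := by
  refine Subtype.ext ?_
  ext ξ h
  change transOp H (1 : G) ξ h = ξ h
  rw [transOp_apply, inv_one, one_mul]

theorem implementer_mul (g h : G) :
    implementer α g * implementer α h = implementer α (g * h) := by
  refine Subtype.ext ?_
  ext ξ k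
  change transOp H g (transOp H h ξ) k = transOp H (g * h) ξ k
  rw [transOp_apply, transOp_apply, transOp_apply, mul_inv_rev, mul_assoc]

theorem star_implementer (g : G) : star (implementer α g) = implementer α g⁻¹ := by
  refine Subtype.ext ?_
  change star (transOp H g) = transOp H g⁻¹
  symm
  refine (ContinuousLinearMap.eq_adjoint_iff _ _).mpr fun ξ ζ => ?_
  rw [PiLp.inner_apply, PiLp.inner_apply]
  refine Fintype.sum_equiv (Equiv.mulLeft g⁻¹).symm _ _ fun k => ?_
  · simp [transOp_apply]

theorem implementer_mul_embed (g : G) (x : Elem N) :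
    implementer α g * embed α x = embed α (α g x) * implementer α g := by
  refine Subtype.ext ?_
  ext ξ k
  change transOp H g (piOp α x ξ) k = piOp α (α g x) (transOp H g ξ) k
  rw [transOp_apply, piOp_apply, piOp_apply, transOp_apply, ← StarAlgEquiv.mul_apply, ← map_mul,
    mul_inv_rev, inv_inv]

theorem star_implementer_mul_embed (g : G) (x : Elem N) :
    star (implementer α g) * embed α x = embed α (α g⁻¹ x) * star (implementer α g) := by
  rw [star_implementer, implementer_mul_embed]

/-- The finite Fourier series with given coefficients. -/
def fourier : (G → Elem N) →ₗ[ℂ] Elem (crossedProduct α) where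
  toFun a := ∑ g, embed α (a g) * implementer α g
  map_add' a b := by simp [add_mul, Finset.sum_add_distrib]
  map_smul' c a := by simp [Finset.smul_sum]

theorem fourier_apply (a : G → Elem N) :
    fourier α a = ∑ g, embed α (a g) * implementer α g := rfl

theorem fourier_mul (a b : G → Elem N) :
    fourier α a * fourier α b = fourier α (fun k => ∑ g, a g * α g (b (g⁻¹ * k))) := by
  rw [fourier_apply, fourier_apply, fourier_apply, Finset.sum_mul]
  simp_rw [map_sum, Finset.sum_mul, Finset.mul_sum]
  rw [Finset.sum_comm (s := (Finset.univ : Finset G)) (t := Finset.univ)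
    (f := fun k g => embed α (a g * α g (b (g⁻¹ * k))) * implementer α k)]
  refine Finset.sum_congr rfl fun g _ => ?_
  refine Fintype.sum_equiv (Equiv.mulLeft g) _ _ fun h => ?_
  simp only [Equiv.coe_mulLeft, inv_mul_cancel_left]
  rw [map_mul, ← implementer_mul, mul_assoc, ← mul_assoc (implementer α g), implementer_mul_embed]
  simp only [mul_assoc]

theorem star_fourier (a : G → Elem N) :
    star (fourier α a) = fourier α (fun k => α k (star (a k⁻¹))) := by
  rw [fourier_apply, fourier_apply, star_sum]
  refine Fintype.sum_equiv (Equiv.inv G) _ _ fun g => ?_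
  rw [star_mul, ← map_star, star_implementer_mul_embed, star_implementer]
  simp

theorem fourier_single [DecidableEq G] (g : G) (x : Elem N) :
    fourier α (Pi.single g x) = embed α x * implementer α g := by
  rw [fourier_apply, Finset.sum_eq_single g]
  · simp
  · intro h _ hg
    simp [hg]
  · simp

/-- The `*`-algebra of finite Fourier series. -/
def fourierAlgebra : StarSubalgebra ℂ (Elem (crossedProduct α)) where
  carrier := Set.range (fourier α)
  mul_mem' := by
    rintro _ _ ⟨a, rfl⟩ ⟨b, rfl⟩
    exact ⟨_, (fourier_mul α a b).symm⟩
  add_mem' := by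
    rintro _ _ ⟨a, rfl⟩ ⟨b, rfl⟩
    exact ⟨a + b, map_add _ _ _⟩
  algebraMap_mem' c := by
    classical
    refine ⟨Pi.single 1 (algebraMap ℂ _ c), ?_⟩
    rw [fourier_single, implementer_one, mul_one, AlgHomClass.commutes]
  star_mem' := by
    rintro _ ⟨a, rfl⟩
    exact ⟨_, (star_fourier α a).symm⟩

/-- The Fourier algebra is closed under `star` and contains the generators, so its commutant lies in
theirs. This is the hypothesis of the density theorem. -/
theorem commute_of_commute_fourierAlgebra (x : Elem (crossedProduct α))
    (y : L2 G H →L[ℂ] L2 G H)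
    (hy : ∀ a ∈ (fourierAlgebra α).map (crossedProduct α).toStarSubalgebra.subtype,
      a * y = y * a) : y * (x : L2 G H →L[ℂ] L2 G H) = x * y := by
  classical
  have hx := x.2
  change (x : L2 G H →L[ℂ] L2 G H) ∈ StarSubalgebra.centralizer ℂ (StarSubalgebra.centralizer ℂ
    (Set.range (piOp α) ∪ Set.range (transOp H)) : Set (L2 G H →L[ℂ] L2 G H)) at hx
  refine ((StarSubalgebra.mem_centralizer_iff ℂ).mp hx y ?_).1
  refine (StarSubalgebra.mem_centralizer_iff ℂ).mpr ?_
  have key : ∀ z ∈ fourierAlgebra α, (z : L2 G H →L[ℂ] L2 G H) * y = y * z ∧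
      star (z : L2 G H →L[ℂ] L2 G H) * y = y * star (z : L2 G H →L[ℂ] L2 G H) := fun z hz =>
    ⟨hy _ ⟨z, hz, rfl⟩, hy _ ⟨star z, (star_mem hz : star z ∈ fourierAlgebra α), rfl⟩⟩
  rintro _ (⟨b, rfl⟩ | ⟨g, rfl⟩)
  · refine key (embed α b) ⟨Pi.single 1 b, ?_⟩
    rw [fourier_single, implementer_one, mul_one]
  · refine key (implementer α g) ⟨Pi.single g 1, ?_⟩
    rw [fourier_single, map_one, one_mul]

end CrossedProductAlgebra

/-! ### Matrix entries of operators on `ℓ²(G, H)`. -/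

section Entries

variable {H : Type*} [NormedAddCommGroup H] [InnerProductSpace ℂ H]
variable {G : Type*} [Fintype G]

open Classical in
/-- The inclusion of `H` in `ℓ²(G, H)` as the summand of index `h`. -/
def inc (h : G) : H →L[ℂ] L2 G H :=
  ((PiLp.continuousLinearEquiv 2 ℂ (fun _ : G => H)).symm : (G → H) →L[ℂ] L2 G H) ∘L
    ContinuousLinearMap.single ℂ (fun _ : G => H) h

theorem inc_apply_self (h : G) (v : H) : inc h v h = v := by
  simp [inc]

theorem inc_apply_of_ne {h g : G} (hg : g ≠ h) (v : H) : inc h v g = 0 := by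
  simp [inc, hg]

theorem sum_inc (ξ : L2 G H) : ∑ h, inc h (ξ h) = ξ := by
  ext g
  rw [WithLp.ofLp_sum, Finset.sum_apply, Finset.sum_eq_single g]
  · exact inc_apply_self _ _
  · intro h _ hg
    exact inc_apply_of_ne hg.symm _
  · simp

theorem norm_inc (h : G) (v : H) : ‖inc h v‖ = ‖v‖ := by
  rw [PiLp.norm_eq_of_L2, Finset.sum_eq_single h]
  · rw [inc_apply_self, Real.sqrt_sq (norm_nonneg _)]
  · intro g _ hg
    rw [inc_apply_of_ne hg]; simp
  · simp

theorem inner_inc_left (h : G) (v : H) (ξ : L2 G H) : inner ℂ (inc h v) ξ = inner ℂ v (ξ h) := by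
  rw [PiLp.inner_apply, Finset.sum_eq_single h]
  · rw [inc_apply_self]
  · intro g _ hg
    rw [inc_apply_of_ne hg, inner_zero_left]
  · simp

/-- The matrix entry of an operator on `ℓ²(G, H)`. -/
def opEntry (g h : G) (T : L2 G H →L[ℂ] L2 G H) : H →L[ℂ] H :=
  PiLp.proj 2 (fun _ : G => H) g ∘L T ∘L inc h

theorem opEntry_apply (g h : G) (T : L2 G H →L[ℂ] L2 G H) (v : H) :
    opEntry g h T v = T (inc h v) g := rfl

theorem ext_opEntry {S T : L2 G H →L[ℂ] L2 G H} (h : ∀ g h, opEntry g h S = opEntry g h T) :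
    S = T := by
  ext1 ξ
  rw [← sum_inc ξ, map_sum, map_sum]
  refine Finset.sum_congr rfl fun k _ => ?_
  ext g
  rw [← opEntry_apply, ← opEntry_apply, h]

end Entries

section CrossedProductEntries

variable {H : Type*} [NormedAddCommGroup H] [InnerProductSpace ℂ H] [CompleteSpace H]
variable {N : VonNeumannAlgebra H}
variable {G : Type*} [Group G] [Fintype G]
variable (α : G →* (Elem N ≃⋆ₐ[ℂ] Elem N))

/-- The diagonal operator on `ℓ²(G, H)` with constant entry. -/
def diagOp (G : Type*) [Fintype G] (b : H →L[ℂ] H) : L2 G H →L[ℂ] L2 G H :=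
  ((PiLp.continuousLinearEquiv 2 ℂ (fun _ : G => H)).symm : (G → H) →L[ℂ] L2 G H) ∘L
    ContinuousLinearMap.pi (fun g => b ∘L PiLp.proj 2 (fun _ : G => H) g)

omit [CompleteSpace H] [Group G] in
theorem diagOp_apply (b : H →L[ℂ] H) (ξ : L2 G H) (g : G) : diagOp G b ξ g = b (ξ g) := rfl

omit [CompleteSpace H] [Group G] in
theorem diagOp_inc (b : H →L[ℂ] H) (h : G) (v : H) : diagOp G b (inc h v) = inc h (b v) := by
  ext g
  rw [diagOp_apply]
  by_cases hg : g = h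
  · subst hg; rw [inc_apply_self, inc_apply_self]
  · rw [inc_apply_of_ne hg, inc_apply_of_ne hg, map_zero]

theorem mem_of_commute_commutant {M : VonNeumannAlgebra H} {T : H →L[ℂ] H}
    (h : ∀ b ∈ M.commutant, b * T = T * b) : T ∈ M := by
  rw [← VonNeumannAlgebra.commutant_commutant M, VonNeumannAlgebra.mem_commutant_iff]
  exact h

theorem apply_commutant {M : VonNeumannAlgebra H} {b : H →L[ℂ] H} (hb : b ∈ M.commutant)
    (x : Elem M) (v : H) : (x : H →L[ℂ] H) (b v) = b ((x : H →L[ℂ] H) v) :=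
  congrArg (fun T : H →L[ℂ] H => T v) (VonNeumannAlgebra.mem_commutant_iff.mp hb x x.2)

/-- The entries of `π(x)` lie in `N` and translations only permute the summands. Consequently matrix
entries of the crossed product commute with `N'`, that is, they lie in `N`. -/
theorem diagOp_commute {b : H →L[ℂ] H} (hb : b ∈ N.commutant) (x : Elem (crossedProduct α)) :
    diagOp G b * (x : L2 G H →L[ℂ] L2 G H) = x * diagOp G b := by
  refine commute_of_commute_fourierAlgebra α x _ ?_
  rintro _ ⟨_, ⟨a, rfl⟩, rfl⟩
  have hterm : ∀ g, (((embed α (a g) * implementer α g : Elem (crossedProduct α)) :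
      L2 G H →L[ℂ] L2 G H)) * diagOp G b = diagOp G b *
        ((embed α (a g) * implementer α g : Elem (crossedProduct α)) : L2 G H →L[ℂ] L2 G H) := by
    intro g
    ext ξ k
    change piOp α (a g) (transOp H g (diagOp G b ξ)) k
      = diagOp G b (piOp α (a g) (transOp H g ξ)) k
    rw [piOp_apply, transOp_apply, diagOp_apply, diagOp_apply, piOp_apply, transOp_apply,
      apply_commutant hb]
  change ((fourier α a : Elem (crossedProduct α)) : L2 G H →L[ℂ] L2 G H) * _ = _ *
    ((fourier α a : Elem (crossedProduct α)) : L2 G H →L[ℂ] L2 G H)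
  rw [fourier_apply, AddSubmonoidClass.coe_finsetSum, Finset.sum_mul, Finset.mul_sum]
  exact Finset.sum_congr rfl fun g _ => hterm g

/-- The matrix entries of an element of the crossed product, as elements of `N`. -/
def entry (g h : G) : Elem (crossedProduct α) →ₗ[ℂ] Elem N where
  toFun x := ⟨opEntry g h (x : L2 G H →L[ℂ] L2 G H), by
    change opEntry g h (x : L2 G H →L[ℂ] L2 G H) ∈ N
    refine mem_of_commute_commutant fun b hb => ?_
    ext v
    change b ((x : L2 G H →L[ℂ] L2 G H) (inc h v) g) = (x : L2 G H →L[ℂ] L2 G H) (inc h (b v)) g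
    have := congrArg (fun T : L2 G H →L[ℂ] L2 G H => T (inc h v) g) (diagOp_commute α hb x)
    simp only [mul_apply_eq_comp] at this
    rw [diagOp_apply, diagOp_inc] at this
    exact this⟩
  map_add' x y := by
    refine Subtype.ext ?_
    ext v
    rfl
  map_smul' c x := by
    refine Subtype.ext ?_
    ext v
    rfl

theorem coe_entry_apply (g h : G) (x : Elem (crossedProduct α)) (v : H) :
    ((entry α g h x : Elem N) : H →L[ℂ] H) v = (x : L2 G H →L[ℂ] L2 G H) (inc h v) g := rfl

theorem ext_entry {x y : Elem (crossedProduct α)} (h : ∀ g h, entry α g h x = entry α g h y) :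
    x = y :=
  Subtype.ext (ext_opEntry fun g k => congrArg Subtype.val (h g k))

theorem entry_fourier (a : G → Elem N) (g h : G) :
    entry α g h (fourier α a) = α g⁻¹ (a (g * h⁻¹)) := by
  rw [fourier_apply, map_sum, Finset.sum_eq_single (g * h⁻¹)]
  · refine Subtype.ext ?_
    ext v
    change piOp α (a (g * h⁻¹)) (transOp H (g * h⁻¹) (inc h v)) g = _
    rw [piOp_apply, transOp_apply]
    have e : (g * h⁻¹)⁻¹ * g = h := by group
    rw [e, inc_apply_self]
  · intro k _ hk
    refine Subtype.ext ?_
    ext v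
    change piOp α (a k) (transOp H k (inc h v)) g = 0
    rw [piOp_apply, transOp_apply]
    have e : k⁻¹ * g ≠ h := fun e => hk (by rw [← e]; group)
    rw [inc_apply_of_ne e, map_zero]
  · simp

end CrossedProductEntries

end SubfactorEntropy

end

/-! ### Fourier expansion and traces on the crossed product. -/

noncomputable section

namespace SubfactorEntropy

attribute [local instance] isClosed_coe

open Filter Topology

theorem summable_norm_sq {K : Type*} [NormedAddCommGroup K] [InnerProductSpace ℂ K] (f : Ell2 K) :
    Summable fun n => ‖f n‖ ^ 2 := by
  simpa using (lp.memℓp f).summable (by norm_num)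

theorem norm_sq_eq_tsum {K : Type*} [NormedAddCommGroup K] [InnerProductSpace ℂ K] (f : Ell2 K) :
    ‖f‖ ^ 2 = ∑' n, ‖f n‖ ^ 2 := by
  simpa using lp.norm_rpow_eq_tsum (p := 2) (by norm_num) f

section CrossedProductTrace

variable {H : Type*} [NormedAddCommGroup H] [InnerProductSpace ℂ H] [CompleteSpace H]
variable {N : VonNeumannAlgebra H} {τN : Elem N →ₗ[ℂ] ℂ} {ΞN : Ell2 H}
variable {G : Type*} [Group G] [Fintype G]
variable (α : G →* (Elem N ≃⋆ₐ[ℂ] Elem N))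

/-- Every vector of `ℓ²(ℕ, H)` has a copy in each of the summands of `ℓ²(G, H)`, and these can be
put together to a vector which controls all the matrix entries of operators. -/
theorem exists_norm_entry_le (Ξ : Ell2 H) : ∃ f : Ell2 (L2 G H),
    ∀ (x : Elem (crossedProduct α)) (g h : G),
      ‖gns Ξ (entry α g h x)‖ ≤ ‖amp (L2 G H) (x : L2 G H →L[ℂ] L2 G H) f‖ := by
  obtain ⟨e⟩ := nonempty_equiv_of_countable (α := ℕ) (β := ℕ × G)
  have hsum : Summable fun p : ℕ × G => ‖Ξ p.1‖ ^ 2 := by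
    have h := (summable_norm_sq Ξ).mul_of_nonneg (g := fun _ : G => (1 : ℝ))
      (Summable.of_finite) (fun n => by positivity) (fun _ => zero_le_one)
    simpa using h
  have hmem : Memℓp (fun n => inc (e n).2 (Ξ (e n).1) : ℕ → L2 G H) 2 := by
    refine memℓp_gen ?_
    have := (e.summable_iff (f := fun p : ℕ × G => ‖Ξ p.1‖ ^ 2)).mpr hsum
    simpa [norm_inc, Function.comp_def] using this
  refine ⟨⟨_, hmem⟩, fun x g h => ?_⟩
  set F := amp (L2 G H) (x : L2 G H →L[ℂ] L2 G H) ⟨_, hmem⟩ with hF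
  refine le_of_sq_le_sq ?_ (norm_nonneg _)
  rw [norm_sq_eq_tsum, norm_sq_eq_tsum F]
  have hinj : Function.Injective fun i : ℕ => e.symm (i, h) := fun i j hij => by
    simpa using hij
  have hle : ∀ i, ‖gns Ξ (entry α g h x) i‖ ^ 2 ≤ ‖F (e.symm (i, h))‖ ^ 2 := by
    intro i
    have e1 : gns Ξ (entry α g h x) i = (F (e.symm (i, h))) g := by
      rw [gns_apply, amp_apply, coe_entry_apply, hF, amp_apply]
      simp
    rw [e1]
    gcongr
    exact PiLp.norm_apply_le _ g
  have hFs := summable_norm_sq F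
  exact (Summable.tsum_le_tsum hle (summable_norm_sq _) (hFs.comp_injective hinj)).trans
    (tsum_comp_le_tsum_of_inj hFs (fun n => by positivity) hinj)

variable (hN : IsFactor N) (hτN : IsFaithfulNormalTracialState τN) (hΞN : Represents ΞN τN)
include hN hτN hΞN

theorem norm_gns_starAlgEquiv (β : Elem N ≃⋆ₐ[ℂ] Elem N) (x : Elem N) :
    ‖gns ΞN (β x)‖ = ‖gns ΞN x‖ := by
  rw [← sq_eq_sq₀ (norm_nonneg _) (norm_nonneg _), hΞN.norm_gns_sq, hΞN.norm_gns_sq, ← map_star,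
    ← map_mul, hN.trace_starAlgEquiv hτN hΞN]

/-- Every element of the crossed product by a finite group is a finite Fourier series. -/
theorem exists_eq_fourier (x : Elem (crossedProduct α)) : ∃ a, x = fourier α a := by
  obtain ⟨f, hf⟩ := exists_norm_entry_le α ΞN
  have hcl := amp_mem_closure_of_mem_centralizer_centralizer
    ((fourierAlgebra α).map (crossedProduct α).toStarSubalgebra.subtype)
    (commute_of_commute_fourierAlgebra α x) f
  -- The density theorem at `f` approximates all entries of `x` simultaneously in the trace norm of
  -- `N` by those of one Fourier series.
  have happrox : ∀ ε : ℝ, 0 < ε → ∃ a : G → Elem N, ∀ g h,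
      ‖gns ΞN (entry α g h x - α g⁻¹ (a (g * h⁻¹)))‖ < ε := by
    intro ε hε
    obtain ⟨_, ⟨_, ⟨_, ⟨a, rfl⟩, rfl⟩, rfl⟩, ha⟩ := Metric.mem_closure_iff.mp hcl ε hε
    refine ⟨a, fun g h => ?_⟩
    rw [← entry_fourier, ← map_sub]
    refine (hf _ g h).trans_lt ?_
    rw [dist_eq_norm] at ha
    have e : amp (L2 G H) ((x - fourier α a : Elem (crossedProduct α)) : L2 G H →L[ℂ] L2 G H) f
        = amp (L2 G H) (x : L2 G H →L[ℂ] L2 G H) f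
          - amp (L2 G H) ((fourier α a : Elem (crossedProduct α)) : L2 G H →L[ℂ] L2 G H) f := by
      rw [AddSubgroupClass.coe_sub, map_sub]
      rfl
    rw [e]
    exact ha
  -- This relation between entries characterises Fourier series. It passes to the limit since
  -- automorphisms preserve the trace norm; the approximating coefficients themselves need not be
  -- followed. The coefficient at `k` is then read off from the entry `(k, 1)`.
  have hrel : ∀ g h, entry α g h x = α h⁻¹ (entry α (g * h⁻¹) 1 x) := by
    intro g h
    refine gns_injective hτN hΞN (sub_eq_zero.mp (norm_eq_zero.mp ?_))
    refine le_antisymm (le_of_forall_pos_lt_add fun ε hε => ?_) (norm_nonneg _)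
    obtain ⟨a, ha⟩ := happrox (ε / 2) (half_pos hε)
    have h1 := ha g h
    have h2 := ha (g * h⁻¹) 1
    rw [← norm_gns_starAlgEquiv hN hτN hΞN (α h⁻¹), map_sub, ← StarAlgEquiv.mul_apply,
      ← map_mul] at h2
    have e : h⁻¹ * (g * h⁻¹)⁻¹ = g⁻¹ := by group
    rw [e, inv_one, mul_one] at h2
    rw [← map_sub]
    have e2 : entry α g h x - α h⁻¹ (entry α (g * h⁻¹) 1 x)
        = (entry α g h x - α g⁻¹ (a (g * h⁻¹)))
          - (α h⁻¹ (entry α (g * h⁻¹) 1 x) - α g⁻¹ (a (g * h⁻¹))) := by abel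
    rw [e2, map_sub]
    have := norm_sub_le (gns ΞN (entry α g h x - α g⁻¹ (a (g * h⁻¹))))
      (gns ΞN (α h⁻¹ (entry α (g * h⁻¹) 1 x) - α g⁻¹ (a (g * h⁻¹))))
    linarith
  refine ⟨fun k => α k (entry α k 1 x), ext_entry α fun g h => ?_⟩
  rw [entry_fourier, hrel g h, ← StarAlgEquiv.mul_apply, ← map_mul]
  congr 2
  group

/-- A tracial state of the crossed product by an outer action vanishes off the diagonal. -/
theorem trace_embed_mul_implementer (hα : IsOuterAction α)
    {τ : Elem (crossedProduct α) →ₗ[ℂ] ℂ} (hτ : IsFaithfulNormalTracialState τ) {g : G}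
    (hg : g ≠ 1) (a : Elem N) : τ (embed α a * implementer α g) = 0 := by
  obtain ⟨Ξ, hΞ⟩ := hτ.exists_represents
  -- For `β = α g` the invariant element satisfies `x T = T α_g(x)`. Taking adjoints, outerness
  -- applies to `T*` and gives `T = 0`.
  obtain ⟨T, c, hc, -, hT, -, hcomm⟩ := exists_twisted_invariant hτN hΞN (α g).toStarAlgHom a
  have hT0 : T = 0 := by
    have h : star T = 0 := hα g hg _ fun x => by
      have := congrArg star (hcomm (star x))
      rw [star_mul, star_mul, star_star] at this
      have e : star ((α g).toStarAlgHom (star x)) = α g x := by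
        change star (α g (star x)) = _
        rw [map_star, star_star]
      rw [e] at this
      exact this.symm
    exact star_eq_zero.mp h
  subst hT0
  rw [map_zero] at hT
  let φ : Elem N →ₗ[ℂ] ℂ :=
    { toFun := fun c => τ (embed α c * implementer α g)
      map_add' := fun x y => by rw [map_add, add_mul, map_add]
      map_smul' := fun r x => by rw [map_smul, smul_mul_assoc, map_smul]; rfl }
  -- Since `v_g u* = α_g(u)* v_g`, twisting `a` by `u` amounts to conjugating `a v_g` by `u`, which
  -- a trace does not see.
  have hφ : ∀ n, φ (c n) = φ a := fun n => by
    refine apply_eq_of_mem_twistedHull (hc n) φ fun u => ?_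
    change τ (embed α ((u : Elem N) * a * star (α g u)) * implementer α g)
      = τ (embed α a * implementer α g)
    have e : embed α ((u : Elem N) * a * star (α g u)) * implementer α g
        = embed α u * (embed α a * implementer α g * embed α (star (u : Elem N))) := by
      rw [← map_star, map_mul, map_mul, mul_assoc, ← implementer_mul_embed]
      simp only [mul_assoc]
    rw [e, hτ.tracial, mul_assoc _ (embed α _) (embed α _), ← map_mul, Unitary.coe_star_mul_self,
      map_one, mul_one]
  have hbound : ∀ (k : G) (n : ℕ), ‖α k (c n)‖ ≤ ‖a‖ := fun k n =>
    (NonUnitalStarAlgHom.norm_apply_le (α k) _).trans (norm_le_of_mem_twistedHull (hc n))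
  -- The restriction of `τ` to `N` has not been compared with `τN`. Instead `c n → 0` in the trace
  -- norm of `N` is turned into strong convergence of `π(c n)`, whose diagonal entries are the
  -- `α_k⁻¹(c n)`, and normality of `τ` finishes.
  have hstrong : ∀ (k : G) (v : H),
      Tendsto (fun n => ((α k (c n) : Elem N) : H →L[ℂ] H) v) atTop (𝓝 0) := by
    intro k v
    have h0 : Tendsto (fun n => gns ΞN (α k (c n))) atTop (𝓝 0) := by
      rw [tendsto_zero_iff_norm_tendsto_zero] at hT ⊢
      refine hT.congr fun n => ?_
      rw [norm_gns_starAlgEquiv hN hτN hΞN]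
    obtain ⟨S, -, hS, hSv⟩ := exists_tendsto_of_cauchySeq hτN hΞN (hbound k) h0.cauchySeq
    have hS0 : S = 0 := by
      refine gns_injective hτN hΞN ?_
      rw [map_zero]
      exact tendsto_nhds_unique hS h0
    rw [hS0] at hSv
    exact hSv v
  have hpi : ∀ ξ : L2 G H, Tendsto (fun n => piOp α (c n) ξ) atTop
      (𝓝 ((0 : L2 G H →L[ℂ] L2 G H) ξ)) := by
    intro ξ
    have h1 : Tendsto (fun n => (fun k => ((α k⁻¹ (c n) : Elem N) : H →L[ℂ] H) (ξ k)))
        atTop (𝓝 (0 : G → H)) := tendsto_pi_nhds.mpr fun k => hstrong k⁻¹ (ξ k)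
    have h2 := ((PiLp.continuousLinearEquiv 2 ℂ (fun _ : G => H)).symm.continuous.tendsto _).comp h1
    rw [map_zero] at h2
    exact h2
  have hpib : ∀ n, ‖piOp α (c n)‖ ≤ ‖a‖ := fun n =>
    (NonUnitalStarAlgHom.norm_apply_le (piHom α) (c n)).trans (norm_le_of_mem_twistedHull (hc n))
  have hlim := tendsto_amp hpib hpi (gns Ξ (implementer α g))
  rw [map_zero] at hlim
  have hφlim : Tendsto (fun n => φ (c n)) atTop (𝓝 0) := by
    have h : ∀ n, φ (c n) = inner ℂ Ξ (amp (L2 G H) (piOp α (c n)) (gns Ξ (implementer α g))) := by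
      intro n
      change τ (embed α (c n) * implementer α g) = _
      rw [hΞ, gns_mul]
      rfl
    simp_rw [h]
    simpa using (tendsto_const_nhds (x := Ξ)).inner hlim
  simp_rw [hφ] at hφlim
  exact tendsto_nhds_unique tendsto_const_nhds hφlim

end CrossedProductTrace

end SubfactorEntropy

end

/-! ### Conditional expectations in a tracial von Neumann algebra. -/

noncomputable section

namespace SubfactorEntropy

attribute [local instance] isClosed_coe

open Filter Topology

section ConditionalExpectation

variable {K : Type*} [NormedAddCommGroup K] [InnerProductSpace ℂ K] [CompleteSpace K]
variable {M : VonNeumannAlgebra K} {τ : Elem M →ₗ[ℂ] ℂ} {B : StarSubalgebra ℂ (Elem M)}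

theorem isPos_iff {x : Elem M} : IsPos x ↔ 0 ≤ (x : K →L[ℂ] K) :=
  (ContinuousLinearMap.nonneg_iff_isPositive _).symm

theorem IsConditionalExpectation.unique (hτ : IsFaithfulNormalTracialState τ)
    {E E' : Elem M →ₗ[ℂ] Elem M} (hE : IsConditionalExpectation τ B E)
    (hE' : IsConditionalExpectation τ B E') : E = E' := by
  have key : ∀ {F : Elem M →ₗ[ℂ] Elem M} (_ : IsConditionalExpectation τ B F) (b : Elem M)
      (_ : b ∈ B) (x : Elem M), τ (b * F x) = τ (b * x) := by
    intro F hF b hb x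
    have h := hF.bimodule b hb 1 (one_mem B) x
    rw [mul_one, mul_one] at h
    rw [← h, hF.trace]
  ext1 x
  rw [← sub_eq_zero]
  refine hτ.faithful _ ?_
  have hd : star (E x - E' x) ∈ B := star_mem (sub_mem (hE.mem x) (hE'.mem x))
  rw [mul_sub, map_sub, key hE _ hd, key hE' _ hd, sub_self]

/-- `condExp` is a choice with default value `0`; existence and uniqueness let an explicit
expectation take its place. -/
theorem IsConditionalExpectation.condExp_eq (hτ : IsFaithfulNormalTracialState τ)
    {E : Elem M →ₗ[ℂ] Elem M} (hE : IsConditionalExpectation τ B E) : condExp τ B = E := by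
  have h : ∃ E, IsConditionalExpectation τ B E := ⟨E, hE⟩
  rw [condExp, dif_pos h]
  exact h.choose_spec.unique hτ hE

theorem mem_conj {u : unitary (Elem M)} {x : Elem M} :
    x ∈ conj u B ↔ ∃ b ∈ B, (u : Elem M) * b * star (u : Elem M) = x := Iff.rfl

theorem isPos_conj {x : Elem M} (hx : IsPos x) (w : Elem M) : IsPos (star w * x * w) := by
  rw [isPos_iff] at hx ⊢
  obtain ⟨s, rfl⟩ := exists_eq_star_mul_self hx
  have := coe_star_mul_self_nonneg (s * w)
  rwa [star_mul, mul_assoc, ← mul_assoc (star s), ← mul_assoc] at this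

/-- Conjugation by `u` turns a conditional expectation onto `B` to one onto `u B u*`. -/
def conjExp (u : unitary (Elem M)) (E : Elem M →ₗ[ℂ] Elem M) : Elem M →ₗ[ℂ] Elem M where
  toFun x := u * E (star (u : Elem M) * x * u) * star (u : Elem M)
  map_add' x y := by rw [mul_add, add_mul, map_add, mul_add, add_mul]
  map_smul' c x := by
    rw [mul_smul_comm, smul_mul_assoc, map_smul, mul_smul_comm, smul_mul_assoc]; rfl

theorem conjExp_apply (u : unitary (Elem M)) (E : Elem M →ₗ[ℂ] Elem M) (x : Elem M) :
    conjExp u E x = u * E (star (u : Elem M) * x * u) * star (u : Elem M) := rfl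

theorem IsConditionalExpectation.conj (hτ : IsFaithfulNormalTracialState τ)
    {E : Elem M →ₗ[ℂ] Elem M} (hE : IsConditionalExpectation τ B E) (u : unitary (Elem M)) :
    IsConditionalExpectation τ (conj u B) (conjExp u E) := by
  have hu : star (u : Elem M) * u = 1 := Unitary.coe_star_mul_self u
  have hu' : ∀ z : Elem M, star (u : Elem M) * (u * z) = z := fun z => by
    rw [← mul_assoc, hu, one_mul]
  refine ⟨fun x => ?_, ?_, ?_, fun x hx => ?_, fun x => ?_⟩
  · exact mem_conj.mpr ⟨_, hE.mem _, rfl⟩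
  · intro x hx
    obtain ⟨b, hb, rfl⟩ := mem_conj.mp hx
    rw [conjExp_apply]
    simp only [mul_assoc, hu', hu, mul_one]
    rw [hE.apply_of_mem b hb]
  · intro x hx y hy z
    obtain ⟨b, hb, rfl⟩ := mem_conj.mp hx
    obtain ⟨c, hc, rfl⟩ := mem_conj.mp hy
    have h := hE.bimodule b hb c hc (star (u : Elem M) * z * u)
    rw [conjExp_apply, conjExp_apply]
    simp only [mul_assoc, hu', hu, mul_one] at h ⊢
    rw [h]
    simp only [mul_assoc]
  · rw [conjExp_apply]
    have h := isPos_conj (hE.positive _ (isPos_conj hx (u : Elem M))) (star (u : Elem M))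
    rwa [star_star] at h
  · rw [conjExp_apply, hτ.tracial, hu', hE.trace, hτ.tracial, ← mul_assoc,
      show (u : Elem M) * star (u : Elem M) = 1 from Unitary.coe_mul_star_self u, one_mul]

/-- `etaOp` uses the functional calculus of all bounded operators, whereas the entropy inequality
uses that of the C*-algebra `M`. -/
theorem etaOp_eq_cfc {x : Elem M} (hx : IsSelfAdjoint x) : etaOp x = cfc Real.negMulLog x :=
  Subtype.ext (StarAlgHom.map_cfc M.toStarSubalgebra.subtype Real.negMulLog x
    Real.continuous_negMulLog.continuousOn continuous_subtype_val hx
    (hx.map M.toStarSubalgebra.subtype)).symm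

end ConditionalExpectation

/-! ### The conditional expectation of the crossed product onto `N`. -/

section CrossedProductExpectation

variable {H : Type*} [NormedAddCommGroup H] [InnerProductSpace ℂ H] [CompleteSpace H]
variable {N : VonNeumannAlgebra H}
variable {G : Type*} [Group G] [Fintype G]
variable (α : G →* (Elem N ≃⋆ₐ[ℂ] Elem N))

theorem isPos_entry (g : G) {x : Elem (crossedProduct α)} (hx : IsPos x) :
    IsPos (entry α g g x) := by
  refine (ContinuousLinearMap.isPositive_iff_complex _).mpr fun v => ?_
  have h := (ContinuousLinearMap.isPositive_iff_complex _).mp hx (inc g v)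
  have e : inner ℂ ((x : L2 G H →L[ℂ] L2 G H) (inc g v)) (inc g v)
      = inner ℂ (((entry α g g x : Elem N) : H →L[ℂ] H) v) v := by
    rw [coe_entry_apply, ← inner_conj_symm, inner_inc_left, inner_conj_symm]
  rwa [e] at h

/-- The conditional expectation of `N ⋊ G` onto `N`. -/
def baseExp : Elem (crossedProduct α) →ₗ[ℂ] Elem (crossedProduct α) :=
  (embed α).toAlgHom.toLinearMap ∘ₗ entry α 1 1

theorem baseExp_fourier (a : G → Elem N) : baseExp α (fourier α a) = embed α (a 1) := by
  change embed α (entry α 1 1 (fourier α a)) = _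
  rw [entry_fourier]
  simp

theorem baseExp_embed_mul_implementer [DecidableEq G] (a : Elem N) (g : G) :
    baseExp α (embed α a * implementer α g) = if g = 1 then embed α a else 0 := by
  rw [← fourier_single, baseExp_fourier]
  split_ifs with h
  · rw [h, Pi.single_eq_same]
  · rw [Pi.single_eq_of_ne (Ne.symm h), map_zero]

theorem entry_embed_mul_mul (b c : Elem N) (x : Elem (crossedProduct α)) :
    entry α 1 1 (embed α b * x * embed α c) = b * entry α 1 1 x * c := by
  refine Subtype.ext ?_
  ext v
  change piOp α b ((x : L2 G H →L[ℂ] L2 G H) (piOp α c (inc 1 v))) 1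
    = (b : H →L[ℂ] H) ((x : L2 G H →L[ℂ] L2 G H) (inc 1 ((c : H →L[ℂ] H) v)) 1)
  have e : piOp α c (inc (1 : G) v) = inc 1 ((c : H →L[ℂ] H) v) := by
    ext g
    rw [piOp_apply]
    by_cases hg : g = 1
    · subst hg; rw [inc_apply_self, inc_apply_self, inv_one, map_one, StarAlgEquiv.one_apply]
    · rw [inc_apply_of_ne hg, inc_apply_of_ne hg, map_zero]
  rw [e, piOp_apply, inv_one, map_one, StarAlgEquiv.one_apply]

/-- Only trace preservation is deep: it combines the Fourier expansion with the vanishing of `τ` on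
`N v_g`, `g ≠ 1`. The other properties hold for the `(1, 1)` matrix entry directly. -/
theorem isConditionalExpectation_baseExp (hN : IsTypeIIOneFactor N) (hα : IsOuterAction α)
    {τ : Elem (crossedProduct α) →ₗ[ℂ] ℂ} (hτ : IsFaithfulNormalTracialState τ) :
    IsConditionalExpectation τ (base α) (baseExp α) := by
  classical
  obtain ⟨τN, hτN⟩ := hN.exists_trace
  obtain ⟨ΞN, hΞN⟩ := hτN.exists_represents
  refine ⟨fun x => ⟨_, rfl⟩, ?_, ?_, fun x hx => ?_, fun x => ?_⟩
  · rintro _ ⟨b, rfl⟩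
    have := baseExp_embed_mul_implementer α b 1
    rwa [if_pos rfl, implementer_one, mul_one] at this
  · rintro _ ⟨b, rfl⟩ _ ⟨c, rfl⟩ x
    change embed α (entry α 1 1 (embed α b * x * embed α c))
      = embed α b * embed α (entry α 1 1 x) * embed α c
    rw [entry_embed_mul_mul, map_mul, map_mul]
  · have h := isPos_iff.mp (isPos_entry α 1 hx)
    refine isPos_iff.mpr ?_
    have := starAlgHom_mono (embed α) (x := 0) (y := entry α 1 1 x) h
    rwa [map_zero] at this
  · obtain ⟨a, rfl⟩ := exists_eq_fourier α hN.factor hτN hΞN x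
    rw [baseExp_fourier, fourier_apply, map_sum, Finset.sum_eq_single 1]
    · rw [implementer_one, mul_one]
    · intro g _ hg
      exact trace_embed_mul_implementer α hN.factor hτN hΞN hα hτ hg (a g)
    · simp

theorem baseExp_star_implementer_mul_embed_mul [DecidableEq G] (c : Elem N) (g h : G) :
    baseExp α (star (implementer α g) * embed α c * implementer α h)
      = if g = h then star (implementer α g) * embed α c * implementer α g else 0 := by
  rw [star_implementer_mul_embed, mul_assoc, star_implementer, implementer_mul,
    baseExp_embed_mul_implementer]
  by_cases hgh : g = h
  · subst hgh
    rw [if_pos (inv_mul_cancel g), if_pos rfl, mul_assoc, implementer_mul, inv_mul_cancel,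
      implementer_one, mul_one]
  · rw [if_neg (fun e => hgh (inv_mul_eq_one.mp e)), if_neg hgh]

/-- The Kraus form of the expectation: a cross term with indices `g ≠ h` lies in `N v_{g⁻¹h}` and is
killed. -/
theorem baseExp_conj_fourier (a : G → Elem N) (y : Elem N) :
    baseExp α (star (fourier α a) * embed α y * fourier α a)
      = ∑ g, star (embed α (a g) * implementer α g) * embed α y
          * (embed α (a g) * implementer α g) := by
  classical
  rw [fourier_apply, star_sum, Finset.sum_mul, Finset.sum_mul, map_sum]
  refine Finset.sum_congr rfl fun g _ => ?_
  have e : ∀ h, star (embed α (a g) * implementer α g) * embed α y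
      * (embed α (a h) * implementer α h)
      = star (implementer α g) * embed α (star (a g) * y * a h) * implementer α h := fun h => by
    rw [star_mul, map_mul, map_mul, map_star]
    simp only [mul_assoc]
  rw [Finset.mul_sum, map_sum]
  simp_rw [e, baseExp_star_implementer_mul_embed_mul]
  simp

theorem sum_mul_star_eq_one {a : G → Elem N} (ha : fourier α a * star (fourier α a) = 1) :
    ∑ g, a g * star (a g) = 1 := by
  have h := congrArg (entry α 1 1) ha
  rw [star_fourier, fourier_mul, entry_fourier] at h
  simp only [inv_one, mul_one, map_one, StarAlgEquiv.one_apply] at h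
  have e : entry α 1 1 (1 : Elem (crossedProduct α)) = 1 := by
    classical
    have := entry_fourier α (Pi.single 1 1) 1 1
    rw [fourier_single, implementer_one, map_one, mul_one] at this
    simpa using this
  rw [e] at h
  rw [← h]
  refine Finset.sum_congr rfl fun g _ => ?_
  rw [← StarAlgEquiv.mul_apply, ← map_mul, inv_inv, mul_inv_cancel, map_one,
    StarAlgEquiv.one_apply]

theorem baseExp_fourier_mul_star_implementer (a : G → Elem N) (g : G) :
    baseExp α (fourier α a * star (implementer α g)) = embed α (a g) := by
  classical
  rw [fourier_apply, Finset.sum_mul, map_sum, Finset.sum_eq_single g]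
  · rw [star_implementer, mul_assoc, implementer_mul, baseExp_embed_mul_implementer,
      if_pos (mul_inv_cancel g)]
  · intro h _ hh
    rw [star_implementer, mul_assoc, implementer_mul, baseExp_embed_mul_implementer,
      if_neg (fun e => hh (mul_inv_eq_one.mp e))]
  · exact fun hg => absurd (Finset.mem_univ g) hg

end CrossedProductExpectation

/-- Among probability vectors on `n` points, only the uniform one has entropy at least `log n`; the
entropy is given here by its variational formula. -/
theorem eq_inv_card_of_log_le {ι : Type*} [Fintype ι] {t : ι → ℝ} (ht : ∀ g, 0 ≤ t g)
    (hsum : ∑ g, t g = 1)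
    (h : ∀ c : ι → ℝ, (∀ g, 0 < c g) → ∑ g, c g = 1 →
      Real.log (Fintype.card ι) ≤ ∑ g, - t g * Real.log (c g)) (g : ι) :
    t g = 1 / (Fintype.card ι : ℝ) := by
  have : Nonempty ι := ⟨g⟩
  set n : ℝ := (Fintype.card ι : ℝ) with hn
  have hn0 : 0 < n := by rw [hn]; exact_mod_cast Fintype.card_pos
  -- The midpoint of `t` and the uniform vector is strictly positive even where `t` vanishes.
  have hc := h (fun g => (t g + 1 / n) / 2)
    (fun g => by have := ht g; positivity)
    (by
      rw [← Finset.sum_div, Finset.sum_add_distrib, hsum]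
      simp [← hn])
  have hterm : ∀ g, (n * t g - 1) ^ 2 / (2 * (n * t g + 1)) / n
      ≤ t g * (Real.log n + Real.log ((t g + 1 / n) / 2)) - (t g - 1 / n) / 2 := by
    intro g
    have h0 := ht g
    have hw : (0 : ℝ) < (t g + 1 / n) / 2 := by positivity
    rw [← Real.log_mul hn0.ne' hw.ne']
    have h1 := Real.one_sub_inv_le_log_of_pos (mul_pos hn0 hw)
    have h2 := mul_le_mul_of_nonneg_left h1 h0
    refine le_trans (le_of_eq ?_) (sub_le_sub_right h2 _)
    have h3 : n * t g + 1 ≠ 0 := by positivity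
    field_simp
    ring
  have hnn : ∀ g, 0 ≤ (n * t g - 1) ^ 2 / (2 * (n * t g + 1)) / n := fun g => by
    have := ht g
    positivity
  have hle : ∑ g, (n * t g - 1) ^ 2 / (2 * (n * t g + 1)) / n ≤ 0 := by
    refine (Finset.sum_le_sum fun g _ => hterm g).trans ?_
    simp_rw [mul_add]
    rw [Finset.sum_sub_distrib, Finset.sum_add_distrib, ← Finset.sum_mul, hsum, ← Finset.sum_div,
      Finset.sum_sub_distrib, hsum]
    simp only [neg_mul, Finset.sum_neg_distrib] at hc
    simp only [Finset.sum_const, Finset.card_univ, nsmul_eq_mul, ← hn]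
    rw [mul_one_div_cancel hn0.ne']
    linarith
  have h0 := (Finset.sum_eq_zero_iff_of_nonneg fun g _ => hnn g).mp
    (le_antisymm hle (Finset.sum_nonneg fun g _ => hnn g)) g (Finset.mem_univ g)
  have hg := ht g
  have h3 : 2 * (n * t g + 1) ≠ 0 := by positivity
  rw [div_eq_zero_iff, div_eq_zero_iff] at h0
  rcases h0 with (h0 | h0) | h0
  · rw [eq_div_iff hn0.ne', mul_comm]
    exact sub_eq_zero.mp (pow_eq_zero_iff two_ne_zero |>.mp h0)
  · exact absurd h0 h3
  · exact absurd h0 hn0.ne'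

end SubfactorEntropy

end

/-! ### The upper bound for the relative entropy. -/

noncomputable section

namespace SubfactorEntropy

attribute [local instance] isClosed_coe

section Bound

variable {H : Type*} [NormedAddCommGroup H] [InnerProductSpace ℂ H] [CompleteSpace H]
variable {N : VonNeumannAlgebra H}
variable {G : Type*} [Group G] [Fintype G]
variable (α : G →* (Elem N ≃⋆ₐ[ℂ] Elem N))

/-- The entropy gained by an element of `N` under the conditional expectation onto `u N u*` is
bounded by the weights of the Fourier coefficients of `u`. -/
theorem entropy_conj_sub_le {τ : Elem (crossedProduct α) →ₗ[ℂ] ℂ}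
    (hτ : IsFaithfulNormalTracialState τ) {u : unitary (Elem (crossedProduct α))}
    {a : G → Elem N} (hu : (u : Elem (crossedProduct α)) = fourier α a) {c : G → ℝ}
    (hc : ∀ g, 0 < c g) {y : Elem N} (hy : IsPos y) :
    (τ (etaOp (conjExp u (baseExp α) (embed α y)))).re - (τ (etaOp (embed α y))).re ≤
      ∑ g, (- (τ (embed α (a g * star (a g)) * embed α y)).re * Real.log (c g)
        + c g * (τ (embed α y)).re - (τ (embed α (a g * star (a g)) * embed α y)).re) := by
  obtain ⟨r, hr, rfl⟩ := exists_eq_mul_self (isPos_iff.mp hy)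
  have hv : ∀ g, implementer α g * star (implementer α g) = 1 := fun g => by
    rw [star_implementer, implementer_mul, mul_inv_cancel, implementer_one]
  have huu : star (u : Elem (crossedProduct α)) * u = 1 := Unitary.coe_star_mul_self u
  have huu' : (u : Elem (crossedProduct α)) * star (u : Elem (crossedProduct α)) = 1 :=
    Unitary.coe_mul_star_self u
  have hrr : star (embed α r) = embed α r := by rw [← map_star, hr]
  -- With `y = r²`, the factor `u*` on the right makes `∑ w_g* w_g` the expectation of `y` onto
  -- `uNu*`, and it cancels in `w_g w_g* = r u_g u_g* r`, whose sum is `y`.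
  let w : G → Elem (crossedProduct α) := fun g =>
    embed α r * (embed α (a g) * implementer α g) * star (u : Elem (crossedProduct α))
  have hZ : ∑ g, star (w g) * w g = conjExp u (baseExp α) (embed α (r * r)) := by
    rw [conjExp_apply, hu, baseExp_conj_fourier, Finset.mul_sum, Finset.sum_mul]
    refine Finset.sum_congr rfl fun g _ => ?_
    simp only [w, star_mul, star_star, hrr, map_mul, mul_assoc, hu]
  have hW : ∀ g, w g * star (w g) = embed α r * embed α (a g * star (a g)) * embed α r := by
    intro g
    have e : w g * star (w g) = embed α r * embed α (a g) * (implementer α g *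
        (star (u : Elem (crossedProduct α)) * u) * star (implementer α g)) *
        (star (embed α (a g)) * star (embed α r)) := by
      simp only [w, star_mul, star_star, mul_assoc]
    rw [e, huu, mul_one, hv, mul_one, hrr, map_mul, map_star]
    simp only [mul_assoc]
  have hX : ∑ g, w g * star (w g) = embed α (r * r) := by
    simp_rw [hW]
    rw [← Finset.sum_mul, ← Finset.mul_sum, ← map_sum, sum_mul_star_eq_one α (hu ▸ huu'), map_one,
      mul_one, map_mul]
  have hWt : ∀ g, τ (w g * star (w g)) = τ (embed α (a g * star (a g)) * embed α (r * r)) := by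
    intro g
    rw [hW, hτ.tracial, ← mul_assoc, ← map_mul, hτ.tracial]
  have hmain := hτ.isRealTrace.entropy_kraus_le w hc
  simp only [LinearMap.comp_apply, LinearMap.restrictScalars_apply, Complex.reLm_coe, hWt, hZ,
    hX] at hmain
  have hXsa : IsSelfAdjoint (embed α (r * r)) :=
    hX ▸ isSelfAdjoint_sum _ fun g _ => IsSelfAdjoint.mul_star_self (w g)
  have hZsa : IsSelfAdjoint (conjExp u (baseExp α) (embed α (r * r))) :=
    hZ ▸ isSelfAdjoint_sum _ fun g _ => IsSelfAdjoint.star_mul_self (w g)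
  rw [etaOp_eq_cfc hXsa, etaOp_eq_cfc hZsa]
  linarith

/-- The bound for a single element is linear in it, and the elements `E_N(x_i)` sum to `1`; so the
total does not depend on the partition. -/
theorem relEntropy_le (hN : IsTypeIIOneFactor N) (hα : IsOuterAction α)
    {τ : Elem (crossedProduct α) →ₗ[ℂ] ℂ} (hτ : IsFaithfulNormalTracialState τ)
    {u : unitary (Elem (crossedProduct α))} {a : G → Elem N}
    (hu : (u : Elem (crossedProduct α)) = fourier α a) {c : G → ℝ} (hc : ∀ g, 0 < c g) :
    relEntropy τ (base α) (conj u (base α)) ≤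
      ((∑ g, (- (τ (embed α (a g * star (a g)))).re * Real.log (c g)
        + c g - (τ (embed α (a g * star (a g)))).re) : ℝ) : EReal) := by
  have hE := isConditionalExpectation_baseExp α hN hα hτ
  refine iSup_le fun n => iSup_le fun x => iSup_le fun ⟨hpos, hsum⟩ => ?_
  rw [EReal.coe_le_coe_iff, (hE.conj hτ u).condExp_eq hτ, hE.condExp_eq hτ]
  have hterm := fun i => entropy_conj_sub_le α hτ hu hc (isPos_entry α 1 (hpos i))
  refine (Finset.sum_le_sum fun i _ => hterm i).trans (le_of_eq ?_)
  rw [Finset.sum_comm]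
  have hsum1 : ∑ i, embed α (entry α 1 1 (x i)) = 1 := by
    rw [← map_sum, ← map_sum, hsum]
    have := hE.apply_of_mem 1 (one_mem _)
    exact this
  have h1 : ∑ i, (τ (embed α (entry α 1 1 (x i)))).re = 1 := by
    rw [← Complex.re_sum, ← map_sum, hsum1, hτ.map_one, Complex.one_re]
  have h2 : ∀ z, ∑ i, (τ (z * embed α (entry α 1 1 (x i)))).re = (τ z).re := fun z => by
    rw [← Complex.re_sum, ← map_sum, ← Finset.mul_sum, hsum1, mul_one]
  refine Finset.sum_congr rfl fun g _ => ?_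
  rw [Finset.sum_sub_distrib, Finset.sum_add_distrib, ← Finset.sum_mul, Finset.sum_neg_distrib,
    ← Finset.mul_sum, h1, h2, mul_one]

end Bound

end SubfactorEntropy

end
-- Conclusion: maximal entropy forces uniform weights.
open SubfactorEntropy in
theorem corollary3p1p5 {H : Type*} [NormedAddCommGroup H] [InnerProductSpace ℂ H]
    [CompleteSpace H] (N : VonNeumannAlgebra H) (hN : IsTypeIIOneFactor N)
    {G : Type*} [Group G] [Fintype G] (α : G →* (Elem N ≃⋆ₐ[ℂ] Elem N)) (hα : IsOuterAction α)
    (τ : Elem (crossedProduct α) →ₗ[ℂ] ℂ) (hτ : IsFaithfulNormalTracialState τ)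
    (u : unitary (Elem (crossedProduct α)))
    (hu : relEntropy τ (base α) (conj u (base α)) = ((Real.log (Fintype.card G) : ℝ) : EReal))
    (g : G) :
    τ (coeff α τ u g * star (coeff α τ u g)) = 1 / (Fintype.card G : ℂ) := by
  obtain ⟨τN, hτN⟩ := hN.exists_trace
  obtain ⟨ΞN, hΞN⟩ := hτN.exists_represents
  obtain ⟨a, ha⟩ := exists_eq_fourier α hN.factor hτN hΞN (u : Elem (crossedProduct α))
  have hcoeff : coeff α τ u g = embed α (a g) := by
    rw [coeff, (isConditionalExpectation_baseExp α hN hα hτ).condExp_eq hτ, ha,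
      baseExp_fourier_mul_star_implementer]
  have hreal : ∀ k, ∃ r : ℝ, 0 ≤ r ∧ τ (embed α (a k * star (a k))) = r := fun k => by
    have := hτ.nonneg (star (embed α (a k)))
    rwa [star_star, ← map_star, ← map_mul] at this
  choose t ht0 ht using hreal
  have huu : (u : Elem (crossedProduct α)) * star (u : Elem (crossedProduct α)) = 1 :=
    Unitary.coe_mul_star_self u
  have hsum : ∑ k, t k = 1 := by
    have h : ((∑ k, t k : ℝ) : ℂ) = 1 := by
      rw [Complex.ofReal_sum]
      simp_rw [← ht]
      rw [← map_sum, ← map_sum, sum_mul_star_eq_one α (ha ▸ huu), map_one, hτ.map_one]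
    exact_mod_cast h
  -- For `c` of total mass `1` the linear terms `∑ c k` and `∑ t k` of the bound cancel, leaving the
  -- variational formula for the entropy of `t`.
  have hlog : ∀ c : G → ℝ, (∀ k, 0 < c k) → ∑ k, c k = 1 →
      Real.log (Fintype.card G) ≤ ∑ k, - t k * Real.log (c k) := by
    intro c hc hc1
    have h := relEntropy_le α hN hα hτ ha hc
    rw [hu, EReal.coe_le_coe_iff] at h
    refine h.trans (le_of_eq ?_)
    simp_rw [ht, Complex.ofReal_re]
    rw [Finset.sum_sub_distrib, Finset.sum_add_distrib, hc1, hsum]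
    ring
  rw [hcoeff, ← map_star, ← map_mul, ht, eq_inv_card_of_log_le ht0 hsum hlog g]
  push_cast
  rfl
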